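/- Let $(X,\mathcal B,m)$ be a probability space and let $\tau:X\to X$ be an invertible, bimeasurable, measure preserving transformation. Let $(\nu_n)_{n\ge 1}$ be a sequence of probability measures on $\mathbb Z$, each strictly aperiodic (its support is not contained in a coset of a proper subgroup of $\mathbb Z$). Write $\hat\nu(t)=\sum_{k\in\mathbb Z}\nu(k)e^{2\pi i k t}$, $E(\nu)=\sum_{k}k\,\nu(k)$ and $m_2(\nu)=\sum_{k}|k|^2\nu(k)$. Assume that 1. $E(\nu_n)=0$ for all $n\ge1$; 2. $\sum_{i=1}^{n}m_2(\nu_i)=O(n)$ as $n\to\infty$ (in particular every $m_2(\nu_i)$ is finite); 3. there are a constant $C>0$ and an integer $N_0>0$ such that $|\hat\nu_n(t)|\le e^{-Ct^2}$ for all $n>N_0$ and all $t\in[-1/2,1/2)$. Let $\mu_n=\nu_1*\cdots*\nu_n$ for $n\ge1$. Then each $\hat\mu_n$ is twice continuously differentiable on $\mathbb R$ and $$\sup_{n\ge1}\int_{-1/2}^{1/2}|\hat\mu_n''(t)|\,|t|\,dt<\infty .$$ Moreover, with $\mu_nf(x)=\sum_{k\in\mathbb Z}\mu_n(k)f(\tau^kx)$,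 the maximal operator $Mf(x)=\sup_{n\ge1}|\mu_nf(x)|$ is of weak type $(1,1)$: there is a constant $C'>0$ such that for every real-valued $f\in L^1(X,m)$ and every $\lambda>0$, $$m\{x\in X: Mf(x)>\lambda\}\le \frac{C'}{\lambda}\,\|f\|_{L^1(m)} .$$ -/

import Mathlib

open MeasureTheory Filter

open scoped ENNReal NNReal

noncomputable section

namespace ConvolutionAverages

/-- A probability measure on `ℤ` is strictly aperiodic if its support is not contained in a coset of
a proper subgroup of `ℤ`. -/
def StrictlyAperiodic (ν : Measure ℤ) : Prop :=
  ¬ ∃ (H : AddSubgroup ℤ) (a : ℤ), H ≠ ⊤ ∧ ∀ k : ℤ, ν {k} ≠ 0 → ∃ h ∈ H, k = a + h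

/-- The expectation `∑ k, k ν(k)`; the series converges absolutely whenever the second moment of
the probability measure `ν` is finite. -/
def expectation (ν : Measure ℤ) : ℝ :=
  ∑' k : ℤ, (k : ℝ) * ν.real {k}

/-- The second moment `∑ k, |k|² ν(k)`, with values in `[0, ∞]`. -/
def secondMoment (ν : Measure ℤ) : ℝ≥0∞ :=
  ∑' k : ℤ, ENNReal.ofReal (|(k : ℝ)| ^ 2) * ν {k}

/-- The Fourier transform `t ↦ ∑ k, ν(k) e^{2πikt}` of a measure on `ℤ`. -/
def fourier (ν : Measure ℤ) (t : ℝ) : ℂ :=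
  ∑' k : ℤ, (ν.real {k} : ℂ) * Complex.exp (2 * Real.pi * Complex.I * k * t)

/-- The convolution `ν 1 ∗ ⋯ ∗ ν n`; the empty convolution (`n = 0`) is the unit mass at `0`. -/
def convProd (ν : ℕ → Measure ℤ) : ℕ → Measure ℤ
  | 0 => Measure.dirac 0
  | n + 1 => (convProd ν n).conv (ν (n + 1))

variable {X : Type*} [MeasurableSpace X]

/-- The iterate `τ ^ k`, `k ∈ ℤ`, of an invertible measurable transformation, as a function. -/
def iter (τ : X ≃ᵐ X) (k : ℤ) : X → X :=
  ⇑((τ.toEquiv : Equiv.Perm X) ^ k)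

/-- The weighted average `∑ k, μ(k) f(τ^k x)`. For integrable `f` and measure preserving `τ` the
series converges absolutely for almost every `x`. -/
def average (τ : X ≃ᵐ X) (μ : Measure ℤ) (f : X → ℝ) (x : X) : ℝ :=
  ∑' k : ℤ, μ.real {k} * f (iter τ k x)

/-- The maximal function `sup_{n ≥ 1} |μ_n f(x)|`, with values in `[0, ∞]`. -/
def maximal (τ : X ≃ᵐ X) (μ : ℕ → Measure ℤ) (f : X → ℝ) (x : X) : ℝ≥0∞ :=
  ⨆ (n : ℕ) (_ : 1 ≤ n), ENNReal.ofReal |average τ (μ n) f x|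

/-- An operator `T` on `L¹(m)` with values in the `[0, ∞]`-valued functions is of weak type
`(1, 1)`: there is a constant `C`, independent of `f` and `lam`, such that
`m {x | T f x > lam} ≤ (C / lam) ‖f‖₁`. -/
def WeakType11 (m : Measure X) (T : (X → ℝ) → X → ℝ≥0∞) : Prop :=
  ∃ C : ℝ, 0 < C ∧ ∀ f : X → ℝ, Integrable f m → ∀ lam : ℝ, 0 < lam →
    m {x | ENNReal.ofReal lam < T f x} ≤ ENNReal.ofReal (C / lam * ∫ x, |f x| ∂m)

end ConvolutionAverages

end

/-! Both conclusions come from one pointwise estimate. Put c = (2π)². A centered ν with finite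
second moment has |ν̂'(t)| ≤ c m₂(ν)|t| and |ν̂''(t)| ≤ c m₂(ν). Leibniz's rule for μ̂_n = ∏ ν̂_i,
the Gaussian decay of all but the first N₀ factors and ∑ m₂(ν_i) = O(n) give, on |t| < 1/2,
|μ̂_n''(t)| ≲ (n + n²t²) exp(-Cnt²) ≲ n exp(-Cnt²/2). Integrated against |t| this is O(1), uniformly
in n (`norm_fourierMoment_convProd_le`, `exists_integral_fourierMoment_le`).

By Fourier inversion this bound says that k ↦ k² μ_n(k) is Lipschitz uniformly in n
(`abs_sq_mul_sub_le`). Hence μ_n(x) ≤ μ_n(y) + D|x - y|/x² whenever 2|x - y| ≤ |x|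
(`smoothness_of_integral_le`), a Hörmander condition that does not depend on n.

For nonnegative kernels of mass at most 1 this condition suffices for a weak (1,1) maximal
inequality on ℤ (`weak_type_int`). After a Calderón–Zygmund decomposition, the part averaged over
blocks is bounded by 2λ and so are its convolutions; no L² theory enters. Only the error made by
averaging has to be summed, and the smoothness estimate makes it integrable. Calderón's transference
carries the inequality to τ (`transference`). -/

noncomputable section

namespace ConvolutionAverages

/-! ### Dyadic intervals and stopping blocks on ℤ -/

/-- The dyadic interval of length `2 ^ s` in `ℤ` that contains `i`. -/
def dyadicBlock (s : ℕ) (i : ℤ) : Finset ℤ :=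
  Finset.Ico (i / 2 ^ s * 2 ^ s) (i / 2 ^ s * 2 ^ s + 2 ^ s)

theorem mem_dyadicBlock {s : ℕ} {i j : ℤ} : j ∈ dyadicBlock s i ↔ j / 2 ^ s = i / 2 ^ s := by
  have h2 : (0 : ℤ) < 2 ^ s := by positivity
  rw [dyadicBlock, Finset.mem_Ico, Int.ediv_eq_iff_of_pos h2]

theorem self_mem_dyadicBlock (s : ℕ) (i : ℤ) : i ∈ dyadicBlock s i := mem_dyadicBlock.2 rfl

theorem card_dyadicBlock (s : ℕ) (i : ℤ) : (dyadicBlock s i).card = 2 ^ s := by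
  rw [dyadicBlock, Int.card_Ico, add_sub_cancel_left]
  exact_mod_cast Int.toNat_natCast (2 ^ s)

theorem natAbs_sub_lt_of_mem_dyadicBlock {s : ℕ} {i j : ℤ} (h : j ∈ dyadicBlock s i) :
    (i - j).natAbs < 2 ^ s := by
  have hi := self_mem_dyadicBlock s i
  rw [dyadicBlock, Finset.mem_Ico] at h hi
  zify
  rw [abs_lt]
  constructor <;> linarith [h.1, h.2, hi.1, hi.2]

theorem dyadicBlock_eq_of_mem {s t : ℕ} (hst : s ≤ t) {i j : ℤ} (h : j ∈ dyadicBlock s i) :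
    dyadicBlock t j = dyadicBlock t i := by
  rw [mem_dyadicBlock] at h
  have : j / 2 ^ t = i / 2 ^ t := by
    obtain ⟨r, rfl⟩ := Nat.exists_eq_add_of_le hst
    rw [pow_add, ← Int.ediv_ediv_of_nonneg (by positivity), h,
      Int.ediv_ediv_of_nonneg (by positivity)]
  rw [dyadicBlock, dyadicBlock, this]

theorem dyadicBlock_subset {s t : ℕ} (hst : s ≤ t) (i : ℤ) :
    dyadicBlock s i ⊆ dyadicBlock t i := fun j hj => by
  rw [← dyadicBlock_eq_of_mem hst hj]
  exact self_mem_dyadicBlock t j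

/-- The stopping blocks of the Calderón–Zygmund decomposition of `φ` at height `lam`: `C i` is the
maximal dyadic interval containing `i` on which the average of `φ` exceeds `lam`, and is empty if
there is no such interval. -/
theorem exists_stopping_blocks (φ : ℤ → ℝ≥0∞) (hφ : ∑' i, φ i ≠ ∞) {lam : ℝ≥0∞} (h0 : lam ≠ 0) :
    ∃ C : ℤ → Finset ℤ,
      (∀ i j, j ∈ C i → i ∈ C j) ∧ (∀ i j, j ∈ C i → C j = C i) ∧
      (∀ i j, j ∈ C i → (i - j).natAbs < (C i).card) ∧
      (∀ i, C i = ∅ → φ i ≤ lam) ∧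
      (∀ i, (C i).Nonempty → lam * (C i).card ≤ ∑ j ∈ C i, φ j) ∧
      (∀ i, ∑ j ∈ C i, φ j ≤ 2 * lam * (C i).card) := by
  classical
  set P : ℤ → ℕ → Prop := fun i s => lam * 2 ^ s < ∑ j ∈ dyadicBlock s i, φ j with hP
  have hPmem : ∀ {i j : ℤ} {s t : ℕ}, s ≤ t → j ∈ dyadicBlock s i → (P j t ↔ P i t) := by
    intro i j s t hst hj
    simp only [hP, dyadicBlock_eq_of_mem hst hj]
  -- The total mass is finite, so no block of length at least 2 ^ S is bad, and a largest bad scale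
  -- exists wherever there is a bad one.
  obtain ⟨S, hS⟩ : ∃ S : ℕ, ∑' i, φ i < lam * 2 ^ S := by
    obtain ⟨n, hn⟩ := ENNReal.exists_nat_mul_gt h0 hφ
    refine ⟨n, hn.trans_le ?_⟩
    rw [mul_comm]
    gcongr
    exact_mod_cast Nat.lt_two_pow_self.le
  have hPS : ∀ i t, S ≤ t → ¬ P i t := by
    intro i t ht h
    refine absurd (h.trans_le (ENNReal.sum_le_tsum _)) (not_lt.2 (hS.le.trans ?_))
    gcongr
    norm_num
  set s : ℤ → ℕ := fun i => Nat.findGreatest (P i) S with hs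
  have hbad : ∀ i, (∃ t, P i t) → P i (s i) := by
    rintro i ⟨t, ht⟩
    exact Nat.findGreatest_spec (P := P i) (not_lt.1 fun h => hPS i t h.le ht) ht
  have hmax : ∀ i t, s i < t → ¬ P i t := by
    intro i t ht h
    rcases le_total t S with h' | h'
    · exact Nat.findGreatest_is_greatest ht h' h
    · exact hPS i t h' h
  -- At scales at least `s i`, points of one stopping block have the same dyadic blocks, hence the
  -- same largest bad scale: stopping blocks are equal or disjoint.
  have hkey : ∀ i j, (∃ t, P i t) → j ∈ dyadicBlock (s i) i → (∃ t, P j t) ∧ s j = s i := by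
    intro i j hi hj
    have hPj : P j (s i) := (hPmem le_rfl hj).2 (hbad i hi)
    refine ⟨⟨_, hPj⟩, le_antisymm ?_ ?_⟩
    · by_contra hlt
      push Not at hlt
      exact hmax i _ hlt ((hPmem hlt.le hj).1 (hbad j ⟨_, hPj⟩))
    · by_contra hlt
      push Not at hlt
      exact hmax j _ hlt hPj
  refine ⟨fun i => if ∃ t, P i t then dyadicBlock (s i) i else ∅, ?_, ?_, ?_, ?_, ?_, ?_⟩
  · intro i j hj
    by_cases hi : ∃ t, P i t
    · simp only [if_pos hi] at hj
      obtain ⟨h1, h2⟩ := hkey i j hi hj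
      simp only [if_pos h1]
      rw [h2, dyadicBlock_eq_of_mem le_rfl hj]
      exact self_mem_dyadicBlock _ _
    · simp [if_neg hi] at hj
  · intro i j hj
    by_cases hi : ∃ t, P i t
    · simp only [if_pos hi] at hj
      obtain ⟨h1, h2⟩ := hkey i j hi hj
      simp only [if_pos h1, if_pos hi]
      rw [h2, dyadicBlock_eq_of_mem le_rfl hj]
    · simp [if_neg hi] at hj
  · intro i j hj
    by_cases hi : ∃ t, P i t
    · simp only [if_pos hi] at hj ⊢
      rw [card_dyadicBlock]
      exact natAbs_sub_lt_of_mem_dyadicBlock hj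
    · simp [if_neg hi] at hj
  · intro i h
    by_cases hi : ∃ t, P i t
    · simp only [if_pos hi] at h
      exact absurd (self_mem_dyadicBlock (s i) i) (by simp [h])
    -- The block of scale 0 is {i}, so its failing to be bad bounds φ i itself.
    · have h1 : ¬ P i 0 := fun h => hi ⟨0, h⟩
      simpa [hP, dyadicBlock, show Finset.Ico i (i + 1) = {i} by
        ext; simp; omega] using h1
  · intro i h
    by_cases hi : ∃ t, P i t
    · simp only [if_pos hi]
      rw [card_dyadicBlock]
      exact_mod_cast (hbad i hi).le
    · simp [if_neg hi] at h
  · intro i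
    by_cases hi : ∃ t, P i t
    · simp only [if_pos hi]
      rw [card_dyadicBlock]
      -- The dyadic parent is not bad and is twice as long; this is the factor 2.
      have h1 := not_lt.1 (hmax i (s i + 1) (Nat.lt_succ_self _))
      calc ∑ j ∈ dyadicBlock (s i) i, φ j ≤ ∑ j ∈ dyadicBlock (s i + 1) i, φ j :=
            Finset.sum_le_sum_of_subset (dyadicBlock_subset (Nat.le_succ _) i)
        _ ≤ _ := h1
        _ = _ := by push_cast; ring
    · simp [if_neg hi]

/-! ### The weak type inequality on ℤ -/

/-- Summing over points and then over their blocks replaces an enumeration of the disjoint blocks.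
This exchange moves the averaging over a block from the kernel to φ. -/
theorem tsum_sum_comm_of_symm {C : ℤ → Finset ℤ} (hC : ∀ i j, j ∈ C i → i ∈ C j)
    (F : ℤ → ℤ → ℝ≥0∞) :
    ∑' i, ∑ j ∈ C i, F i j = ∑' j, ∑ i ∈ C j, F i j := by
  classical
  have h1 : ∀ (G : ℤ → ℝ≥0∞) (i : ℤ), ∑ j ∈ C i, G j = ∑' j, if j ∈ C i then G j else 0 := by
    intro G i
    rw [tsum_eq_sum (s := C i) (fun j hj => if_neg hj)]
    exact Finset.sum_congr rfl fun j hj => (if_pos hj).symm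
  simp_rw [h1]
  rw [ENNReal.tsum_comm]
  refine tsum_congr fun j => tsum_congr fun i => ?_
  exact if_congr ⟨hC i j, hC j i⟩ rfl rfl

/-- Multiplied by the block length l, this tail is at most 2: the sum, outside the doubled block, of
the smoothness error l/d². -/
theorem tsum_inv_sq_tail_le {l : ℕ} (hl : 0 < l) :
    ∑' d : ℤ, (if 2 * l ≤ d.natAbs then ((d.natAbs : ℝ≥0∞) ^ 2)⁻¹ else 0) ≤ 2 * (l : ℝ≥0∞)⁻¹ := by
  have hN : ∑' d : ℕ, (if 2 * l ≤ d then ((d : ℝ≥0∞) ^ 2)⁻¹ else 0) ≤ (l : ℝ≥0∞)⁻¹ := by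
    refine ENNReal.tsum_le_of_sum_range_le fun N => ?_
    rw [← Finset.sum_filter]
    have hsub : (Finset.range N).filter (fun d => 2 * l ≤ d) = Finset.Ioo (2 * l - 1) N := by
      ext d
      simp only [Finset.mem_filter, Finset.mem_range, Finset.mem_Ioo]
      omega
    rw [hsub]
    have h2 := sum_Ioo_inv_sq_le (α := ℝ) (2 * l - 1) N
    have h3 : ∑ i ∈ Finset.Ioo (2 * l - 1) N, ((i : ℝ≥0∞) ^ 2)⁻¹
        = ENNReal.ofReal (∑ i ∈ Finset.Ioo (2 * l - 1) N, ((i : ℝ) ^ 2)⁻¹) := by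
      rw [ENNReal.ofReal_sum_of_nonneg (fun i _ => by positivity)]
      refine Finset.sum_congr rfl fun i hi => ?_
      have : 0 < i := by
        rw [Finset.mem_Ioo] at hi
        omega
      rw [ENNReal.ofReal_inv_of_pos (by positivity), ENNReal.ofReal_pow (by positivity),
        ENNReal.ofReal_natCast]
    rw [h3, ← ENNReal.ofReal_natCast, ← ENNReal.ofReal_inv_of_pos (by positivity)]
    refine ENNReal.ofReal_le_ofReal (h2.trans (le_of_eq ?_))
    rw [Nat.cast_sub (by omega)]
    push_cast
    field_simp
    ring
  have hle : ∑' d : ℤ, (if 2 * l ≤ d.natAbs then ((d.natAbs : ℝ≥0∞) ^ 2)⁻¹ else 0)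
      ≤ ∑' d : ℕ, (if 2 * l ≤ d then ((d : ℝ≥0∞) ^ 2)⁻¹ else 0)
        + ∑' d : ℕ, (if 2 * l ≤ d then ((d : ℝ≥0∞) ^ 2)⁻¹ else 0) := by
    rw [tsum_of_nat_of_neg_add_one ENNReal.summable ENNReal.summable]
    refine add_le_add (le_of_eq (by simp)) ?_
    have : ∀ n : ℕ, (-((n : ℤ) + 1)).natAbs = n + 1 := fun n => by omega
    simp_rw [this]
    exact ENNReal.tsum_comp_le_tsum_of_injective (f := fun n : ℕ => n + 1)
      (fun a b h => by simpa using h) (fun d : ℕ => if 2 * l ≤ d then ((d : ℝ≥0∞) ^ 2)⁻¹ else 0)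
  rw [two_mul (l : ℝ≥0∞)⁻¹]
  exact hle.trans (add_le_add hN hN)

theorem tsum_ball_le (i : ℤ) (l : ℕ) :
    ∑' j : ℤ, (if (i - j).natAbs < l then (1 : ℝ≥0∞) else 0) ≤ 2 * l := by
  rw [tsum_eq_sum (s := Finset.Ioo (i - l) (i + l))]
  · calc ∑ j ∈ Finset.Ioo (i - l) (i + l), (if (i - j).natAbs < l then (1 : ℝ≥0∞) else 0)
        ≤ ∑ j ∈ Finset.Ioo (i - (l : ℤ)) (i + l), 1 :=
          Finset.sum_le_sum fun j _ => by split_ifs <;> simp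
      _ = ((i + l - (i - l) - 1 : ℤ).toNat : ℝ≥0∞) := by simp
      _ ≤ ((2 * l : ℕ) : ℝ≥0∞) := by
          refine Nat.cast_le.2 ?_
          omega
      _ = 2 * l := by push_cast; rfl
  · intro j hj
    rw [Finset.mem_Ioo] at hj
    rw [if_neg]
    omega

/-- **Calderón–Zygmund type weak `(1, 1)` inequality on `ℤ`** for the maximal operator attached to
a family of nonnegative kernels of mass at most `1`, subject to a uniform smoothness estimate. -/
theorem weak_type_int {ι : Type*} (K : ι → ℤ → ℝ≥0∞) (hK1 : ∀ n, ∑' k, K n k ≤ 1) (D : ℝ≥0∞)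
    (hK : ∀ n (x y : ℤ), 2 * (x - y).natAbs ≤ x.natAbs →
      K n x ≤ K n y + D * ((x - y).natAbs * ((x.natAbs : ℝ≥0∞) ^ 2)⁻¹))
    (φ : ℤ → ℝ≥0∞) {lam : ℝ≥0∞} (h0 : lam ≠ 0) (htop : lam ≠ ∞) :
    ∑' j, Set.indicator {j : ℤ | ∃ n, 3 * lam < ∑' k, K n k * φ (j + k)} (1 : ℤ → ℝ≥0∞) j
      ≤ (6 + 2 * D) * (∑' i, φ i) * lam⁻¹ := by
  classical
  by_cases hφ : ∑' i, φ i = ∞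
  · rw [hφ, ENNReal.mul_top (by simp), ENNReal.top_mul (by simpa using htop)]
    exact le_top
  obtain ⟨C, hsymm, hCeq, hdist, hgood, hlow, hup⟩ := exists_stopping_blocks φ hφ h0
  set l : ℤ → ℕ := fun i => (C i).card with hl
  have hlpos : ∀ {i}, (C i).Nonempty → 0 < l i := fun h => Finset.card_pos.2 h
  have hcancel : ∀ {i}, (C i).Nonempty → (l i : ℝ≥0∞) * (l i : ℝ≥0∞)⁻¹ = 1 := fun h =>
    ENNReal.mul_inv_cancel (by exact_mod_cast (hlpos h).ne') (ENNReal.natCast_ne_top _)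
  -- `E` is at least 1 near a stopping block, where nothing is estimated; `H` is the error, away
  -- from the blocks, of averaging the kernel over each block.
  set E : ℤ → ℝ≥0∞ := fun j => ∑' i, if (C i).Nonempty then
    (if (i - j).natAbs < 3 * l i then (l i : ℝ≥0∞)⁻¹ else 0) else 0 with hE
  set H : ℤ → ℝ≥0∞ := fun j => ∑' i, D * φ i * (if (C i).Nonempty then
    l i * (if 2 * l i ≤ (i - j).natAbs then (((i - j).natAbs : ℝ≥0∞) ^ 2)⁻¹ else 0) else 0) with hH
  have hpt : ∀ j, Set.indicator {j : ℤ | ∃ n, 3 * lam < ∑' k, K n k * φ (j + k)}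
      (1 : ℤ → ℝ≥0∞) j ≤ E j + H j * lam⁻¹ := by
    intro j
    by_cases hj : ∃ i, (C i).Nonempty ∧ (i - j).natAbs < 2 * l i
    · obtain ⟨i, hi, hij⟩ := hj
      refine le_trans ?_ le_self_add
      refine (Set.indicator_le_self' (fun _ _ => zero_le) _).trans ?_
      -- If j is within 2l of one point of a block of length l, it is within 3l of all l of its
      -- points, each contributing 1/l to `E j`.
      calc (1 : ℝ≥0∞) = ∑ i' ∈ C i, (l i : ℝ≥0∞)⁻¹ := by
            rw [Finset.sum_const, nsmul_eq_mul]
            exact (hcancel hi).symm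
        _ = ∑ i' ∈ C i, (if (C i').Nonempty then
              (if (i' - j).natAbs < 3 * l i' then (l i' : ℝ≥0∞)⁻¹ else 0) else 0) := by
            refine Finset.sum_congr rfl fun i' hi' => ?_
            have h1 : l i' = l i := by simp only [hl, hCeq i i' hi']
            have h2 := hdist i i' hi'
            rw [if_pos ⟨i, hsymm i i' hi'⟩, h1, if_pos]
            simp only [hl] at hij ⊢
            omega
        _ ≤ _ := ENNReal.sum_le_tsum _
    · push Not at hj
      refine le_trans ?_ le_add_self
      by_cases hjS : ∃ n, 3 * lam < ∑' k, K n k * φ (j + k)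
      swap
      · rw [Set.indicator_of_notMem (by simpa using hjS)]
        exact zero_le
      refine (Set.indicator_le_self' (fun _ _ => zero_le) _).trans ?_
      obtain ⟨n, hn⟩ := hjS
      have hshift : ∑' k, K n k * φ (j + k) = ∑' i, K n (i - j) * φ i := by
        rw [← (Equiv.addLeft j).tsum_eq (fun i => K n (i - j) * φ i)]
        simp
      have hmass : ∑' i, K n (i - j) ≤ 1 := by
        exact ((Equiv.subRight j).tsum_eq (fun i => K n i)).trans_le (hK1 n)
      -- On a stopping block, K(i - j) is replaced by its average over i' in the block; the
      -- smoothness estimate applies since |i - i'| < l and |i - j| ≥ 2l.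
      have hterm : ∀ i, K n (i - j) * φ i ≤
          ((if (C i).Nonempty then 0 else 2 * lam * K n (i - j)) +
            ∑ i' ∈ C i, (l i : ℝ≥0∞)⁻¹ * (K n (i' - j) * φ i)) +
          D * φ i * (if (C i).Nonempty then
            l i * (if 2 * l i ≤ (i - j).natAbs then (((i - j).natAbs : ℝ≥0∞) ^ 2)⁻¹ else 0)
            else 0) := by
        intro i
        by_cases hi : (C i).Nonempty
        · have hfar := hj i hi
          rw [if_pos hi, if_pos hi, if_pos hfar, zero_add]
          set q : ℝ≥0∞ := (((i - j).natAbs : ℝ≥0∞) ^ 2)⁻¹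
          calc K n (i - j) * φ i
              = ∑ i' ∈ C i, (l i : ℝ≥0∞)⁻¹ * (K n (i - j) * φ i) := by
                rw [Finset.sum_const, nsmul_eq_mul, ← mul_assoc, hcancel hi, one_mul]
            _ ≤ ∑ i' ∈ C i, ((l i : ℝ≥0∞)⁻¹ * (K n (i' - j) * φ i) +
                  (l i : ℝ≥0∞)⁻¹ * (D * φ i * (l i * q))) := by
                refine Finset.sum_le_sum fun i' hi' => ?_
                rw [← mul_add]
                refine mul_le_mul_right ?_ _
                have hd := hdist i i' hi'
                have h1 := hK n (i - j) (i' - j) (by simp only [hl] at hfar; omega)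
                have h2 : (i - j - (i' - j)).natAbs ≤ l i := by simp only [hl]; omega
                calc K n (i - j) * φ i
                    ≤ (K n (i' - j) + D * ((i - j - (i' - j)).natAbs * q)) * φ i := by
                      gcongr
                  _ ≤ (K n (i' - j) + D * (l i * q)) * φ i := by
                      gcongr
                  _ = _ := by ring
            _ = _ := by
                rw [Finset.sum_add_distrib]
                congr 1
                rw [Finset.sum_const, nsmul_eq_mul, ← mul_assoc, hcancel hi, one_mul]
        · rw [if_neg hi, if_neg hi]
          have h1 := hgood i (Finset.not_nonempty_iff_eq_empty.1 hi)
          refine le_trans ?_ le_self_add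
          refine le_trans ?_ le_self_add
          calc K n (i - j) * φ i ≤ K n (i - j) * (2 * lam) := by
                gcongr
                exact h1.trans (by rw [two_mul]; exact le_self_add)
            _ = _ := mul_comm _ _
      -- After exchanging i and i', each K(i - j) is weighted by a block average of φ, at most 2λ,
      -- or by the 2λ allotted off the blocks. Total kernel mass at most 1 then gives 2λ, so
      -- exceeding 3λ forces `H j` to be at least λ.
      have hmain : ∑' i, K n (i - j) * φ i ≤ 2 * lam + H j := by
        refine (ENNReal.tsum_le_tsum hterm).trans ?_
        rw [ENNReal.tsum_add, ENNReal.tsum_add, tsum_sum_comm_of_symm hsymm, ← ENNReal.tsum_add]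
        refine add_le_add ?_ le_rfl
        calc _ ≤ ∑' i, 2 * lam * K n (i - j) := by
              refine ENNReal.tsum_le_tsum fun i => ?_
              by_cases hi : (C i).Nonempty
              · rw [if_pos hi, zero_add]
                calc ∑ i' ∈ C i, (l i' : ℝ≥0∞)⁻¹ * (K n (i - j) * φ i')
                    = ∑ i' ∈ C i, (l i : ℝ≥0∞)⁻¹ * K n (i - j) * φ i' := by
                      refine Finset.sum_congr rfl fun i' hi' => ?_
                      simp only [hl, hCeq i i' hi']
                      ring
                  _ = (l i : ℝ≥0∞)⁻¹ * K n (i - j) * ∑ i' ∈ C i, φ i' := by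
                      rw [Finset.mul_sum]
                  _ ≤ (l i : ℝ≥0∞)⁻¹ * K n (i - j) * (2 * lam * l i) := by
                      gcongr
                      exact hup i
                  _ = (l i * (l i : ℝ≥0∞)⁻¹) * (2 * lam * K n (i - j)) := by ring
                  _ ≤ _ := by rw [hcancel hi, one_mul]
              · rw [if_neg hi, Finset.not_nonempty_iff_eq_empty.1 hi]
                simp
          _ = 2 * lam * ∑' i, K n (i - j) := ENNReal.tsum_mul_left
          _ ≤ 2 * lam := by
              calc _ ≤ 2 * lam * 1 := by gcongr
                _ = _ := mul_one _
      have h3 : 2 * lam + lam ≤ 2 * lam + H j := by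
        refine le_trans (le_of_eq (by ring)) ((hn.le.trans_eq hshift).trans hmain)
      have h4 : lam ≤ H j :=
        (ENNReal.add_le_add_iff_left (ENNReal.mul_ne_top (by simp) htop)).1 h3
      calc (1 : ℝ≥0∞) = lam * lam⁻¹ := (ENNReal.mul_inv_cancel h0 htop).symm
        _ ≤ H j * lam⁻¹ := by gcongr
  -- Each bad point contributes at most 2 · 3l/l = 6, and the bad points of a block number at most
  -- λ⁻¹ times its φ-mass.
  have hEsum : ∑' j, E j ≤ 6 * (∑' i, φ i) * lam⁻¹ := by
    calc ∑' j, E j = ∑' i, ∑' j, (if (C i).Nonempty then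
          (if (i - j).natAbs < 3 * l i then (l i : ℝ≥0∞)⁻¹ else 0) else 0) := ENNReal.tsum_comm
      _ ≤ ∑' i, ∑ i' ∈ C i, 6 * lam⁻¹ * ((l i : ℝ≥0∞)⁻¹ * φ i') := by
          refine ENNReal.tsum_le_tsum fun i => ?_
          by_cases hi : (C i).Nonempty
          · simp only [if_pos hi]
            have h1 : ∀ j : ℤ, (if (i - j).natAbs < 3 * l i then (l i : ℝ≥0∞)⁻¹ else 0)
                = (l i : ℝ≥0∞)⁻¹ * (if (i - j).natAbs < 3 * l i then 1 else 0) := fun j => by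
              split_ifs <;> simp
            simp_rw [h1]
            rw [ENNReal.tsum_mul_left]
            calc _ ≤ (l i : ℝ≥0∞)⁻¹ * (2 * (3 * l i : ℕ)) := by
                  gcongr
                  exact tsum_ball_le i (3 * l i)
              _ = 6 * (lam * lam⁻¹) * (l i : ℝ≥0∞)⁻¹ * l i := by
                  rw [ENNReal.mul_inv_cancel h0 htop]
                  push_cast
                  ring
              _ = 6 * lam⁻¹ * (l i : ℝ≥0∞)⁻¹ * (lam * l i) := by ring
              _ ≤ 6 * lam⁻¹ * (l i : ℝ≥0∞)⁻¹ * ∑ i' ∈ C i, φ i' := by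
                  gcongr
                  exact hlow i hi
              _ = _ := by
                  rw [Finset.mul_sum]
                  exact Finset.sum_congr rfl fun _ _ => by ring
          · simp [if_neg hi]
      _ = ∑' i, ∑ i' ∈ C i, 6 * lam⁻¹ * ((l i' : ℝ≥0∞)⁻¹ * φ i) :=
          tsum_sum_comm_of_symm hsymm _
      _ ≤ ∑' i, 6 * lam⁻¹ * φ i := by
          refine ENNReal.tsum_le_tsum fun i => ?_
          calc ∑ i' ∈ C i, 6 * lam⁻¹ * ((l i' : ℝ≥0∞)⁻¹ * φ i)
              = ∑ i' ∈ C i, 6 * lam⁻¹ * ((l i : ℝ≥0∞)⁻¹ * φ i) := by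
                refine Finset.sum_congr rfl fun i' hi' => ?_
                simp only [hl, hCeq i i' hi']
            _ = l i * (6 * lam⁻¹ * ((l i : ℝ≥0∞)⁻¹ * φ i)) := by
                rw [Finset.sum_const, nsmul_eq_mul]
            _ = (l i * (l i : ℝ≥0∞)⁻¹) * (6 * lam⁻¹ * φ i) := by ring
            _ ≤ 1 * (6 * lam⁻¹ * φ i) := by
                gcongr
                exact ENNReal.mul_inv_le_one _
            _ = _ := one_mul _
      _ = _ := by rw [ENNReal.tsum_mul_left]; ring
  have hHsum : ∑' j, H j ≤ 2 * D * ∑' i, φ i := by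
    calc ∑' j, H j = ∑' i, ∑' j, D * φ i * (if (C i).Nonempty then
          l i * (if 2 * l i ≤ (i - j).natAbs then (((i - j).natAbs : ℝ≥0∞) ^ 2)⁻¹ else 0) else 0) :=
          ENNReal.tsum_comm
      _ ≤ ∑' i, 2 * D * φ i := by
          refine ENNReal.tsum_le_tsum fun i => ?_
          rw [ENNReal.tsum_mul_left]
          by_cases hi : (C i).Nonempty
          · simp only [if_pos hi]
            rw [ENNReal.tsum_mul_left]
            have h1 := (Equiv.subLeft i).tsum_eq
              (fun d : ℤ => if 2 * l i ≤ d.natAbs then ((d.natAbs : ℝ≥0∞) ^ 2)⁻¹ else 0)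
            simp only [Equiv.subLeft_apply] at h1
            rw [h1]
            calc _ ≤ D * φ i * (l i * (2 * (l i : ℝ≥0∞)⁻¹)) := by
                  gcongr
                  exact tsum_inv_sq_tail_le (hlpos hi)
              _ = 2 * D * φ i * (l i * (l i : ℝ≥0∞)⁻¹) := by ring
              _ ≤ _ := by rw [hcancel hi, mul_one]
          · simp [if_neg hi]
      _ = _ := ENNReal.tsum_mul_left
  calc _ ≤ ∑' j, (E j + H j * lam⁻¹) := ENNReal.tsum_le_tsum hpt
    _ = ∑' j, E j + (∑' j, H j) * lam⁻¹ := by rw [ENNReal.tsum_add, ENNReal.tsum_mul_right]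
    _ ≤ 6 * (∑' i, φ i) * lam⁻¹ + 2 * D * (∑' i, φ i) * lam⁻¹ := by gcongr
    _ = _ := by ring

/-! ### Calderón's transference principle -/

section Transference

variable {X : Type*} [MeasurableSpace X]

theorem iter_add (τ : X ≃ᵐ X) (j k : ℤ) (x : X) : iter τ (j + k) x = iter τ k (iter τ j x) := by
  rw [add_comm, iter, zpow_add]
  rfl

theorem measurePreserving_iter {m : Measure X} {τ : X ≃ᵐ X} (hτ : MeasurePreserving τ m m)
    (k : ℤ) : MeasurePreserving (iter τ k) m m := by
  have hone : iter τ 1 = τ := by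
    ext x
    rw [iter, zpow_one]
    rfl
  have hneg : iter τ (-1) = τ.symm := by
    ext x
    rw [iter, zpow_neg, zpow_one]
    rfl
  have hcomp : ∀ j k, iter τ (j + k) = iter τ k ∘ iter τ j := fun j k => by
    ext x
    exact iter_add τ j k x
  induction k with
  | zero =>
    have : iter τ 0 = id := by
      ext x
      rw [iter, zpow_zero]
      rfl
    rw [this]
    exact MeasurePreserving.id m
  | succ n ih =>
    rw [hcomp, hone]
    exact hτ.comp ih
  | pred n ih =>
    rw [sub_eq_add_neg, hcomp, hneg]
    exact (hτ.symm τ).comp ih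

/-- **Calderón's transference principle** for finitely supported kernels. -/
theorem transference_of_finite_range {ι : Type*} [Countable ι] {m : Measure X}
    {τ : X ≃ᵐ X} (hτ : MeasurePreserving τ m m) (K : ι → ℤ → ℝ≥0∞) {A lam : ℝ≥0∞}
    (hA : ∀ φ : ℤ → ℝ≥0∞, ∑' j, Set.indicator {j : ℤ | ∃ n, lam < ∑' k, K n k * φ (j + k)}
      (1 : ℤ → ℝ≥0∞) j ≤ A * ∑' i, φ i)
    {g : X → ℝ≥0∞} (hg : Measurable g) (R : ℕ) :
    m {x | ∃ n, lam < ∑ k ∈ Finset.Icc (-(R : ℤ)) R, K n k * g (iter τ k x)}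
      ≤ A * ∫⁻ x, g x ∂m := by
  set E := {x | ∃ n, lam < ∑ k ∈ Finset.Icc (-(R : ℤ)) R, K n k * g (iter τ k x)} with hE
  have hit := fun k => measurePreserving_iter hτ k
  have hgi : ∀ k, Measurable fun x => g (iter τ k x) := fun k => hg.comp (hit k).measurable
  have hEm : MeasurableSet E := by
    rw [hE, Set.ofPred_exists]
    exact MeasurableSet.iUnion fun n => measurableSet_lt measurable_const
      (Finset.measurable_sum _ fun k _ => (hgi k).const_mul _)
  have hEi : ∀ k, Measurable fun x => E.indicator (1 : X → ℝ≥0∞) (iter τ k x) := fun k =>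
    (measurable_one.indicator hEm).comp (hit k).measurable
  have hpt : ∀ (L : ℕ) x, ∑ j ∈ Finset.range L, E.indicator (1 : X → ℝ≥0∞) (iter τ j x)
      ≤ A * ∑ i ∈ Finset.Ico (-(R : ℤ)) (L + R), g (iter τ i x) := by
    intro L x
    -- The orbit of g is cut off to the window that the kernels, supported in [-R, R], see from
    -- times 0, …, L - 1.
    set φ : ℤ → ℝ≥0∞ := fun i =>
      if i ∈ Finset.Ico (-(R : ℤ)) (L + R) then g (iter τ i x) else 0 with hφ
    have hφsum : ∑' i, φ i = ∑ i ∈ Finset.Ico (-(R : ℤ)) (L + R), g (iter τ i x) := by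
      rw [tsum_eq_sum (s := Finset.Ico (-(R : ℤ)) (L + R)) (fun i hi => if_neg hi)]
      exact Finset.sum_congr rfl fun i hi => if_pos hi
    rw [← hφsum]
    refine le_trans ?_ (hA φ)
    have hinj : Set.InjOn (fun j : ℕ => (j : ℤ)) (Finset.range L : Set ℕ) :=
      fun a _ b _ h => by simpa using h
    calc ∑ j ∈ Finset.range L, E.indicator (1 : X → ℝ≥0∞) (iter τ j x)
        ≤ ∑ j ∈ Finset.range L, Set.indicator {j : ℤ | ∃ n, lam < ∑' k, K n k * φ (j + k)}
            (1 : ℤ → ℝ≥0∞) j := by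
          refine Finset.sum_le_sum fun j hj => ?_
          by_cases hx : iter τ j x ∈ E
          · obtain ⟨n, hn⟩ := id hx
            rw [Set.indicator_of_mem hx, Set.indicator_of_mem]
            · rfl
            refine ⟨n, hn.trans_le ?_⟩
            refine le_trans (Finset.sum_le_sum fun k hk => ?_)
              (ENNReal.sum_le_tsum (Finset.Icc (-(R : ℤ)) R))
            rw [Finset.mem_Icc] at hk
            rw [Finset.mem_range] at hj
            simp only [hφ]
            rw [if_pos (by rw [Finset.mem_Ico]; omega), iter_add]
          · rw [Set.indicator_of_notMem hx]
            exact zero_le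
      _ = ∑ j ∈ (Finset.range L).image (fun j : ℕ => (j : ℤ)),
            Set.indicator {j : ℤ | ∃ n, lam < ∑' k, K n k * φ (j + k)} (1 : ℤ → ℝ≥0∞) j := by
          rw [Finset.sum_image hinj]
      _ ≤ _ := ENNReal.sum_le_tsum _
  have hint : ∀ L : ℕ, L * m E ≤ (L + 2 * R) * (A * ∫⁻ x, g x ∂m) := by
    intro L
    have h1 := lintegral_mono (μ := m) (hpt L)
    rw [lintegral_finsetSum _ (fun (j : ℕ) _ => hEi j), lintegral_const_mul _
      (Finset.measurable_sum _ fun k _ => hgi k), lintegral_finsetSum _ (fun k _ => hgi k)] at h1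
    have h2 : ∀ j : ℤ, ∫⁻ x, E.indicator (1 : X → ℝ≥0∞) (iter τ j x) ∂m = m E := fun j => by
      rw [(hit j).lintegral_comp (measurable_one.indicator hEm), lintegral_indicator_one hEm]
    have h3 : ∀ j : ℤ, ∫⁻ x, g (iter τ j x) ∂m = ∫⁻ x, g x ∂m := fun j =>
      (hit j).lintegral_comp hg
    simp only [h2, h3, Finset.sum_const, nsmul_eq_mul, Finset.card_range, Int.card_Ico] at h1
    refine h1.trans (le_of_eq ?_)
    have h4 : ((L : ℤ) + R - -R).toNat = L + 2 * R := by omega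
    rw [h4]
    push_cast
    ring
  set B := A * ∫⁻ x, g x ∂m
  by_cases hB : B = ∞
  · rw [hB]
    exact le_top
  refine ENNReal.le_of_forall_pos_le_add fun ε hε _ => ?_
  -- Dividing by L leaves the boundary term 2RB/L, which is below ε for large L.
  obtain ⟨L, hL⟩ := ENNReal.exists_nat_mul_gt (a := (ε : ℝ≥0∞)) (b := 2 * R * B)
    (by exact_mod_cast hε.ne') (by finiteness)
  have hL0 : (L : ℝ≥0∞) ≠ 0 := by
    rintro h
    simp [h] at hL
  rw [← ENNReal.mul_le_mul_iff_right hL0 (ENNReal.natCast_ne_top L)]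
  calc L * m E ≤ (L + 2 * R) * B := hint L
    _ = L * B + 2 * R * B := by ring
    _ ≤ L * B + L * ε := by gcongr
    _ = _ := by ring

/-- **Calderón's transference principle**: a weak type inequality for maximal convolution operators
on `ℤ` passes to the maximal operators attached to a measure preserving transformation. -/
theorem transference {ι : Type*} [Countable ι] {m : Measure X}
    {τ : X ≃ᵐ X} (hτ : MeasurePreserving τ m m) (K : ι → ℤ → ℝ≥0∞) {A lam : ℝ≥0∞}
    (hA : ∀ φ : ℤ → ℝ≥0∞, ∑' j, Set.indicator {j : ℤ | ∃ n, lam < ∑' k, K n k * φ (j + k)}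
      (1 : ℤ → ℝ≥0∞) j ≤ A * ∑' i, φ i)
    {g : X → ℝ≥0∞} (hg : Measurable g) :
    m {x | ∃ n, lam < ∑' k, K n k * g (iter τ k x)} ≤ A * ∫⁻ x, g x ∂m := by
  have hmono : Monotone fun R : ℕ =>
      {x | ∃ n, lam < ∑ k ∈ Finset.Icc (-(R : ℤ)) R, K n k * g (iter τ k x)} := by
    rintro R S hRS x ⟨n, hn⟩
    refine ⟨n, hn.trans_le (Finset.sum_le_sum_of_subset ?_)⟩
    exact Finset.Icc_subset_Icc (by simpa using hRS) (by simpa using hRS)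
  have hsub : {x | ∃ n, lam < ∑' k, K n k * g (iter τ k x)} ⊆
      ⋃ R : ℕ, {x | ∃ n, lam < ∑ k ∈ Finset.Icc (-(R : ℤ)) R, K n k * g (iter τ k x)} := by
    rintro x ⟨n, hn⟩
    rw [ENNReal.tsum_eq_iSup_sum, lt_iSup_iff] at hn
    obtain ⟨s, hs⟩ := hn
    obtain ⟨R, hR⟩ : ∃ R : ℕ, s ⊆ Finset.Icc (-(R : ℤ)) R := by
      refine ⟨s.sup Int.natAbs, fun k hk => ?_⟩
      have := Finset.le_sup (f := Int.natAbs) hk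
      rw [Finset.mem_Icc]
      omega
    exact Set.mem_iUnion.2 ⟨R, n, hs.trans_le (Finset.sum_le_sum_of_subset hR)⟩
  refine (measure_mono hsub).trans ?_
  rw [hmono.measure_iUnion]
  exact iSup_le fun R => transference_of_finite_range hτ K hA hg R

/-- A uniform smoothness estimate for the weights implies the weak type `(1, 1)` of the maximal
operator. -/
theorem weakType11_maximal {m : Measure X} {τ : X ≃ᵐ X} (hτ : MeasurePreserving τ m m)
    (μ : ℕ → Measure ℤ) (hμ : ∀ n, 1 ≤ n → IsProbabilityMeasure (μ n)) {D : ℝ≥0∞} (hD : D ≠ ∞)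
    (hsmooth : ∀ n, 1 ≤ n → ∀ x y : ℤ, 2 * (x - y).natAbs ≤ x.natAbs →
      μ n {x} ≤ μ n {y} + D * ((x - y).natAbs * ((x.natAbs : ℝ≥0∞) ^ 2)⁻¹)) :
    WeakType11 m (maximal τ μ) := by
  have hAtop : 3 * (6 + 2 * D) ≠ ∞ := by finiteness
  refine ⟨(3 * (6 + 2 * D)).toReal, ENNReal.toReal_pos (by simp) hAtop, fun f hf lam hlam => ?_⟩
  -- A measurable representative; by invariance of m it agrees with f along the whole orbit of
  -- almost every point.
  set f' := hf.1.mk f with hf'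
  have hf'm : Measurable fun x => ‖f' x‖ₑ := hf.1.stronglyMeasurable_mk.measurable.enorm
  have hae : ∀ᵐ x ∂m, ∀ k, f (iter τ k x) = f' (iter τ k x) :=
    ae_all_iff.2 fun k =>
      (measurePreserving_iter hτ k).quasiMeasurePreserving.ae_eq_comp hf.1.ae_eq_mk
  set K : {n : ℕ // 1 ≤ n} → ℤ → ℝ≥0∞ := fun n k => μ n {k} with hK
  -- The inequality on ℤ concerns the level 3c, hence the third and the factor 3 in the constant.
  set c : ℝ≥0∞ := ENNReal.ofReal (lam / 3) with hc
  have hc0 : c ≠ 0 := by simpa [hc] using hlam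
  have h3c : 3 * c = ENNReal.ofReal lam := by
    rw [hc, show (3 : ℝ≥0∞) = ENNReal.ofReal 3 by simp, ← ENNReal.ofReal_mul (by norm_num)]
    congr 1
    ring
  have hweak := fun φ => weak_type_int K (fun n => by
    have := hμ n n.2
    have h1 := lintegral_countable' (μ := μ n) (fun _ => (1 : ℝ≥0∞))
    simp only [one_mul, lintegral_const, measure_univ] at h1
    exact h1.symm.le) D (fun n x y h => hsmooth n n.2 x y h) φ hc0 ENNReal.ofReal_ne_top
  have htr := transference hτ K (A := (6 + 2 * D) * c⁻¹) (lam := 3 * c)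
    (fun φ => (hweak φ).trans_eq (by ring)) hf'm
  have hle : m {x | ENNReal.ofReal lam < maximal τ μ f x} ≤
      m {x | ∃ n, 3 * c < ∑' k, K n k * ‖f' (iter τ k x)‖ₑ} := by
    refine measure_mono_ae ?_
    filter_upwards [hae] with x hx hlt
    change ENNReal.ofReal lam < maximal τ μ f x at hlt
    simp only [maximal, lt_iSup_iff] at hlt
    obtain ⟨n, hn, hlt⟩ := hlt
    have := hμ n hn
    refine ⟨⟨n, hn⟩, ?_⟩
    rw [h3c]
    refine hlt.trans_le ?_
    rw [← Real.enorm_eq_ofReal_abs, average]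
    refine enorm_tsum_le_tsum_enorm.trans (ENNReal.tsum_le_tsum fun k => ?_)
    rw [enorm_mul, hx k, Real.enorm_eq_ofReal measureReal_nonneg, ofReal_measureReal]
  refine (hle.trans htr).trans (le_of_eq ?_)
  have hnorm : ∫⁻ x, ‖f' x‖ₑ ∂m = ENNReal.ofReal (∫ x, |f x| ∂m) := by
    have h1 : ∫⁻ x, ‖f' x‖ₑ ∂m = ∫⁻ x, ‖f x‖ₑ ∂m := by
      refine lintegral_congr_ae ?_
      filter_upwards [hf.1.ae_eq_mk] with x hx
      rw [hf', ← hx]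
    rw [h1, ← ofReal_integral_norm_eq_lintegral_enorm hf]
    rfl
  rw [hnorm, ENNReal.ofReal_mul (by positivity), ENNReal.ofReal_div_of_pos hlam,
    ENNReal.ofReal_toReal hAtop, ← h3c, div_eq_mul_inv,
    ENNReal.mul_inv (Or.inl (by simp)) (Or.inl (by simp))]
  congr 1
  calc (6 + 2 * D) * c⁻¹ = (3 * 3⁻¹) * ((6 + 2 * D) * c⁻¹) := by
        rw [ENNReal.mul_inv_cancel (by simp) (by simp), one_mul]
    _ = _ := by ring

end Transference

/-! ### Derivatives of the Fourier transform and moments -/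

section FourierMoments

/-- The termwise `j`-th derivative of the Fourier transform of `ν`. -/
def fourierMoment (ν : Measure ℤ) (j : ℕ) (t : ℝ) : ℂ :=
  ∑' k : ℤ, (ν.real {k} : ℂ) * (2 * Real.pi * Complex.I * k) ^ j *
    Complex.exp (2 * Real.pi * Complex.I * k * t)

theorem fourierMoment_zero (ν : Measure ℤ) : fourierMoment ν 0 = fourier ν := by
  ext t
  simp [fourierMoment, fourier]

theorem norm_character (k : ℤ) (t : ℝ) :
    ‖Complex.exp (2 * Real.pi * Complex.I * k * t)‖ = 1 := by
  rw [show (2 * Real.pi * Complex.I * k * t : ℂ) = ((2 * Real.pi * k * t : ℝ) : ℂ) * Complex.I by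
    push_cast; ring, Complex.norm_exp_ofReal_mul_I]

theorem norm_fourierMoment_term (ν : Measure ℤ) (j : ℕ) (k : ℤ) (t : ℝ) :
    ‖(ν.real {k} : ℂ) * (2 * Real.pi * Complex.I * k) ^ j *
      Complex.exp (2 * Real.pi * Complex.I * k * t)‖ =
      (2 * Real.pi) ^ j * (|(k : ℝ)| ^ j * ν.real {k}) := by
  rw [norm_mul, norm_character, norm_mul, norm_pow]
  simp only [norm_mul, Complex.norm_real, Complex.norm_I, Complex.norm_intCast, Complex.norm_ofNat,
    Real.norm_eq_abs, abs_of_pos Real.pi_pos, abs_of_nonneg (measureReal_nonneg (μ := ν)), mul_one]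
  ring

theorem hasSum_measureReal_singleton (ν : Measure ℤ) [IsProbabilityMeasure ν] :
    HasSum (fun k : ℤ => ν.real {k}) 1 := by
  have h1 := lintegral_countable' (μ := ν) (fun _ => (1 : ℝ≥0∞))
  simp only [one_mul, lintegral_const, measure_univ] at h1
  have h2 := ENNReal.hasSum_toReal (f := fun k : ℤ => ν {k}) (by rw [← h1]; simp)
  rw [← ENNReal.tsum_toReal_eq (fun k => measure_ne_top ν _), ← h1] at h2
  simpa [measureReal_def] using h2

variable {ν : Measure ℤ}

theorem hasSum_secondMoment (hν : secondMoment ν ≠ ∞) :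
    HasSum (fun k : ℤ => |(k : ℝ)| ^ 2 * ν.real {k}) (secondMoment ν).toReal := by
  have h2 := ENNReal.hasSum_toReal hν
  rw [← ENNReal.tsum_toReal_eq (ENNReal.ne_top_of_tsum_ne_top hν)] at h2
  have h3 : ∀ k : ℤ, |(k : ℝ)| ^ 2 * ν.real {k} =
      (ENNReal.ofReal (|(k : ℝ)| ^ 2) * ν {k}).toReal := fun k => by
    rw [ENNReal.toReal_mul, ENNReal.toReal_ofReal (by positivity), measureReal_def]
  simp_rw [h3]
  exact h2

theorem summable_moment [IsProbabilityMeasure ν] (hν : secondMoment ν ≠ ∞) {j : ℕ} (hj : j ≤ 2) :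
    Summable fun k : ℤ => |(k : ℝ)| ^ j * ν.real {k} := by
  refine Summable.of_nonneg_of_le (fun k => by positivity) (fun k => ?_)
    ((hasSum_measureReal_singleton ν).summable.add (hasSum_secondMoment hν).summable)
  rw [← one_add_mul]
  gcongr
  rcases le_total |(k : ℝ)| 1 with h | h
  · exact (pow_le_one₀ (abs_nonneg _) h).trans (by simp [sq_nonneg])
  · exact (pow_le_pow_right₀ h hj).trans (by simp)

theorem summable_fourierMoment_term [IsProbabilityMeasure ν] (hν : secondMoment ν ≠ ∞) {j : ℕ}
    (hj : j ≤ 2) (t : ℝ) : Summable fun k : ℤ =>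
      (ν.real {k} : ℂ) * (2 * Real.pi * Complex.I * k) ^ j *
        Complex.exp (2 * Real.pi * Complex.I * k * t) := by
  refine Summable.of_norm ?_
  simp_rw [norm_fourierMoment_term]
  exact (summable_moment hν hj).mul_left _

/-- Termwise differentiation, dominated by the moment of order j + 1, which is finite for j + 1 ≤ 2.
-/
theorem hasDerivAt_fourierMoment [IsProbabilityMeasure ν] (hν : secondMoment ν ≠ ∞) {j : ℕ}
    (hj : j < 2) (t : ℝ) : HasDerivAt (fourierMoment ν j) (fourierMoment ν (j + 1) t) t := by
  refine hasDerivAt_tsum (𝕜 := ℝ)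
    (u := fun k : ℤ => (2 * Real.pi) ^ (j + 1) * (|(k : ℝ)| ^ (j + 1) * ν.real {k}))
    ((summable_moment hν hj).mul_left _) (fun k y => ?_)
    (fun k y => (norm_fourierMoment_term ν (j + 1) k y).le) (y₀ := 0)
    (summable_fourierMoment_term hν hj.le 0) t
  have h1 : HasDerivAt (fun y : ℝ => (2 * Real.pi * Complex.I * k * y : ℂ))
      (2 * Real.pi * Complex.I * k) y := by
    simpa using (Complex.ofRealCLM.hasDerivAt (x := y)).const_mul (2 * Real.pi * Complex.I * k : ℂ)
  refine (h1.cexp.const_mul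
    ((ν.real {k} : ℂ) * (2 * Real.pi * Complex.I * k) ^ j)).congr_deriv ?_
  ring

theorem continuous_fourierMoment [IsProbabilityMeasure ν] (hν : secondMoment ν ≠ ∞) {j : ℕ}
    (hj : j ≤ 2) : Continuous (fourierMoment ν j) := by
  refine continuous_tsum
    (u := fun k : ℤ => (2 * Real.pi) ^ j * (|(k : ℝ)| ^ j * ν.real {k})) (fun k => by fun_prop)
    ((summable_moment hν hj).mul_left _) (fun k y => (norm_fourierMoment_term ν j k y).le)

theorem deriv_fourierMoment [IsProbabilityMeasure ν] (hν : secondMoment ν ≠ ∞) {j : ℕ}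
    (hj : j < 2) : deriv (fourierMoment ν j) = fourierMoment ν (j + 1) :=
  funext fun t => (hasDerivAt_fourierMoment hν hj t).deriv

theorem contDiff_two_fourier [IsProbabilityMeasure ν] (hν : secondMoment ν ≠ ∞) :
    ContDiff ℝ 2 (fourier ν) := by
  have hd : ∀ j < 2, Differentiable ℝ (fourierMoment ν j) := fun j hj t =>
    (hasDerivAt_fourierMoment hν hj t).differentiableAt
  rw [← fourierMoment_zero, show (2 : WithTop ℕ∞) = 1 + 1 by norm_num, contDiff_succ_iff_deriv,
    deriv_fourierMoment hν (by norm_num), contDiff_one_iff_deriv,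
    deriv_fourierMoment hν (by norm_num)]
  exact ⟨hd 0 (by norm_num), by simp, hd 1 (by norm_num), continuous_fourierMoment hν le_rfl⟩

theorem iteratedDeriv_two_fourier [IsProbabilityMeasure ν] (hν : secondMoment ν ≠ ∞) :
    iteratedDeriv 2 (fourier ν) = fourierMoment ν 2 := by
  rw [← fourierMoment_zero, iteratedDeriv_succ, iteratedDeriv_one,
    deriv_fourierMoment hν (by norm_num), deriv_fourierMoment hν (by norm_num)]

theorem norm_fourier_le_one [IsProbabilityMeasure ν] (t : ℝ) : ‖fourier ν t‖ ≤ 1 := by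
  rw [← fourierMoment_zero]
  refine tsum_of_norm_bounded (hasSum_measureReal_singleton ν) fun k => ?_
  rw [norm_fourierMoment_term]
  simp

theorem norm_fourierMoment_two_le (hν : secondMoment ν ≠ ∞) (t : ℝ) :
    ‖fourierMoment ν 2 t‖ ≤ (2 * Real.pi) ^ 2 * (secondMoment ν).toReal :=
  tsum_of_norm_bounded ((hasSum_secondMoment hν).mul_left _) fun k =>
    (norm_fourierMoment_term ν 2 k t).le

theorem fourierMoment_one_zero (hexp : expectation ν = 0) : fourierMoment ν 1 0 = 0 := by
  have h : fourierMoment ν 1 0 = 2 * Real.pi * Complex.I * (expectation ν : ℂ) := by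
    rw [fourierMoment, expectation, Complex.ofReal_tsum, ← tsum_mul_left]
    refine tsum_congr fun k => ?_
    push_cast
    simp
    ring
  rw [h, hexp]
  simp

/-- Centering makes the first derivative vanish at 0, and the mean value inequality with the bound
on the second derivative gives the factor |t|. -/
theorem norm_fourierMoment_one_le [IsProbabilityMeasure ν] (hν : secondMoment ν ≠ ∞)
    (hexp : expectation ν = 0) (t : ℝ) :
    ‖fourierMoment ν 1 t‖ ≤ (2 * Real.pi) ^ 2 * (secondMoment ν).toReal * |t| := by
  have h := convex_univ.norm_image_sub_le_of_norm_hasDerivWithin_le (𝕜 := ℝ)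
    (fun x _ => (hasDerivAt_fourierMoment hν (j := 1) (by norm_num) x).hasDerivWithinAt)
    (fun x _ => norm_fourierMoment_two_le hν x) (Set.mem_univ 0) (Set.mem_univ t)
  simpa [fourierMoment_one_zero hexp] using h

theorem fourier_eq_integral [IsProbabilityMeasure ν] (t : ℝ) :
    fourier ν t = ∫ k : ℤ, Complex.exp (2 * Real.pi * Complex.I * k * t) ∂ν := by
  rw [integral_countable]
  · refine tsum_congr fun k => ?_
    rw [Complex.real_smul]
  · exact Integrable.of_bound (by fun_prop) 1 (ae_of_all _ fun k => (norm_character k t).le)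

theorem fourier_conv (μ ν : Measure ℤ) [IsProbabilityMeasure μ] [IsProbabilityMeasure ν] (t : ℝ) :
    fourier (μ.conv ν) t = fourier μ t * fourier ν t := by
  rw [fourier_eq_integral, fourier_eq_integral, fourier_eq_integral, integral_conv]
  · rw [← integral_mul_const]
    refine integral_congr_ae (ae_of_all _ fun x => ?_)
    simp only
    rw [← integral_const_mul]
    refine integral_congr_ae (ae_of_all _ fun y => ?_)
    simp only
    rw [← Complex.exp_add]
    congr 1
    push_cast
    ring
  · exact Integrable.of_bound (by fun_prop) 1 (ae_of_all _ fun k => (norm_character k t).le)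

theorem secondMoment_eq_lintegral (ν : Measure ℤ) :
    secondMoment ν = ∫⁻ k : ℤ, ENNReal.ofReal (|(k : ℝ)| ^ 2) ∂ν := by
  rw [lintegral_countable', secondMoment]

/-- From (x + y)² ≤ 2x² + 2y². Only finiteness is needed, to differentiate twice; growth in n is
controlled on the Fourier side. -/
theorem secondMoment_conv_ne_top {μ ν : Measure ℤ} [IsProbabilityMeasure μ]
    [IsProbabilityMeasure ν] (hμ : secondMoment μ ≠ ∞) (hν : secondMoment ν ≠ ∞) :
    secondMoment (μ.conv ν) ≠ ∞ := by
  rw [secondMoment_eq_lintegral] at hμ hν ⊢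
  rw [Measure.lintegral_conv (by fun_prop)]
  have h : ∀ x y : ℤ, ENNReal.ofReal (|((x + y : ℤ) : ℝ)| ^ 2) ≤
      2 * ENNReal.ofReal (|(x : ℝ)| ^ 2) + 2 * ENNReal.ofReal (|(y : ℝ)| ^ 2) := by
    intro x y
    rw [show (2 : ℝ≥0∞) = ENNReal.ofReal 2 by simp, ← ENNReal.ofReal_mul (by norm_num),
      ← ENNReal.ofReal_mul (by norm_num), ← ENNReal.ofReal_add (by positivity) (by positivity)]
    refine ENNReal.ofReal_le_ofReal ?_
    simp only [sq_abs]
    push_cast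
    nlinarith [sq_nonneg ((x : ℝ) - y)]
  refine ne_top_of_le_ne_top ?_ (lintegral_mono fun x => lintegral_mono fun y => h x y)
  simp_rw [lintegral_add_left measurable_const, lintegral_const, measure_univ, mul_one]
  rw [lintegral_add_right _ measurable_const, lintegral_const_mul _ (by fun_prop),
    lintegral_const_mul _ (by fun_prop), lintegral_const, measure_univ, mul_one]
  finiteness

/-! ### Fourier inversion and smoothness of the weights -/

theorem integral_character (j : ℤ) :
    ∫ t in (-(1 / 2) : ℝ)..(1 / 2), Complex.exp (2 * Real.pi * Complex.I * j * t) =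
      if j = 0 then 1 else 0 := by
  split_ifs with h
  · subst h
    simp
    norm_num
  · have hc : (2 * Real.pi * Complex.I * j : ℂ) ≠ 0 := by
      simp [Real.pi_ne_zero, h]
    rw [integral_exp_mul_complex hc, div_eq_zero_iff]
    left
    rw [sub_eq_zero, Complex.exp_eq_exp_iff_exists_int]
    exact ⟨j, by push_cast; ring⟩

theorem integral_fourierMoment_two [IsProbabilityMeasure ν] (hν : secondMoment ν ≠ ∞) (x : ℤ) :
    ∫ t in (-(1 / 2) : ℝ)..(1 / 2), fourierMoment ν 2 t *
      Complex.exp (2 * Real.pi * Complex.I * (-x : ℤ) * t) =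
      -(2 * Real.pi) ^ 2 * ((x : ℝ) ^ 2 * ν.real {x} : ℝ) := by
  have h := intervalIntegral.hasSum_integral_of_dominated_convergence
    (a := -(1 / 2)) (b := 1 / 2) (μ := volume)
    (F := fun (k : ℤ) (t : ℝ) => (ν.real {k} : ℂ) * (2 * Real.pi * Complex.I * k) ^ 2 *
      Complex.exp (2 * Real.pi * Complex.I * k * t) *
      Complex.exp (2 * Real.pi * Complex.I * (-x : ℤ) * t))
    (f := fun t => fourierMoment ν 2 t * Complex.exp (2 * Real.pi * Complex.I * (-x : ℤ) * t))
    (fun k _ => (2 * Real.pi) ^ 2 * (|(k : ℝ)| ^ 2 * ν.real {k}))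
    (fun k => by fun_prop)
    (fun k => ae_of_all _ fun t _ => by
      rw [norm_mul, norm_fourierMoment_term, norm_character, mul_one])
    (ae_of_all _ fun t _ => (summable_moment hν le_rfl).mul_left _)
    (by simp)
    (ae_of_all _ fun t _ => (summable_fourierMoment_term hν le_rfl t).hasSum.mul_right _)
  rw [← h.tsum_eq, tsum_eq_single x]
  · have h1 : ∀ t : ℝ, (ν.real {x} : ℂ) * (2 * Real.pi * Complex.I * x) ^ 2 *
        Complex.exp (2 * Real.pi * Complex.I * x * t) *
        Complex.exp (2 * Real.pi * Complex.I * (-x : ℤ) * t) =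
        (ν.real {x} : ℂ) * (2 * Real.pi * Complex.I * x) ^ 2 := fun t => by
      rw [mul_assoc, ← Complex.exp_add]
      push_cast
      ring_nf
      simp
    simp_rw [h1]
    rw [intervalIntegral.integral_const]
    norm_num [mul_pow]
    ring
  · intro k hk
    have h1 : ∀ t : ℝ, (ν.real {k} : ℂ) * (2 * Real.pi * Complex.I * k) ^ 2 *
        Complex.exp (2 * Real.pi * Complex.I * k * t) *
        Complex.exp (2 * Real.pi * Complex.I * (-x : ℤ) * t) =
        (ν.real {k} : ℂ) * (2 * Real.pi * Complex.I * k) ^ 2 *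
          Complex.exp (2 * Real.pi * Complex.I * (k - x : ℤ) * t) := fun t => by
      rw [mul_assoc, ← Complex.exp_add]
      congr 2
      push_cast
      ring
    simp_rw [h1]
    rw [intervalIntegral.integral_const_mul, integral_character, if_neg (sub_ne_zero.2 hk),
      mul_zero]

theorem norm_character_sub_le (x y : ℤ) (t : ℝ) :
    ‖Complex.exp (2 * Real.pi * Complex.I * x * t) -
      Complex.exp (2 * Real.pi * Complex.I * y * t)‖ ≤ 2 * Real.pi * |(x : ℝ) - y| * |t| := by
  have h : Complex.exp (2 * Real.pi * Complex.I * x * t) -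
      Complex.exp (2 * Real.pi * Complex.I * y * t) =
      Complex.exp (2 * Real.pi * Complex.I * y * t) *
        (Complex.exp (Complex.I * (2 * Real.pi * (x - y) * t : ℝ)) - 1) := by
    rw [mul_sub, ← Complex.exp_add, mul_one]
    congr 2
    push_cast
    ring
  rw [h, norm_mul, norm_character, one_mul]
  refine Real.norm_exp_I_mul_ofReal_sub_one_le.trans (le_of_eq ?_)
  rw [Real.norm_eq_abs, abs_mul, abs_mul, abs_of_pos Real.two_pi_pos]

/-- Up to the factor -(2π)², x² ν(x) is a Fourier coefficient of ν̂''. Subtracting two coefficients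
leaves a difference of characters, at most 2π|x - y||t|, which supplies the weight |t|. -/
theorem abs_sq_mul_sub_le [IsProbabilityMeasure ν] (hν : secondMoment ν ≠ ∞) {J : ℝ}
    (hJ : ∫ t in (-(1 / 2) : ℝ)..(1 / 2), ‖fourierMoment ν 2 t‖ * |t| ≤ J) (x y : ℤ) :
    |(x : ℝ) ^ 2 * ν.real {x} - (y : ℝ) ^ 2 * ν.real {y}| ≤ J * |(x : ℝ) - y| := by
  have hc := continuous_fourierMoment hν le_rfl
  have hpi : (1 : ℝ) ≤ 2 * Real.pi := by linarith [Real.pi_gt_three]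
  have h1 : ∫ t in (-(1 / 2) : ℝ)..(1 / 2), fourierMoment ν 2 t *
      (Complex.exp (2 * Real.pi * Complex.I * (-x : ℤ) * t) -
        Complex.exp (2 * Real.pi * Complex.I * (-y : ℤ) * t)) =
      -(2 * Real.pi) ^ 2 *
        ((x : ℝ) ^ 2 * ν.real {x} - (y : ℝ) ^ 2 * ν.real {y} : ℝ) := by
    simp_rw [mul_sub]
    rw [intervalIntegral.integral_sub, integral_fourierMoment_two hν,
      integral_fourierMoment_two hν]
    · push_cast
      ring
    · exact Continuous.intervalIntegrable (by fun_prop) _ _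
    · exact Continuous.intervalIntegrable (by fun_prop) _ _
  have h2 := intervalIntegral.norm_integral_le_of_norm_le (a := -(1 / 2)) (b := 1 / 2)
    (μ := volume) (by norm_num)
    (f := fun t => fourierMoment ν 2 t *
      (Complex.exp (2 * Real.pi * Complex.I * (-x : ℤ) * t) -
        Complex.exp (2 * Real.pi * Complex.I * (-y : ℤ) * t)))
    (g := fun t => 2 * Real.pi * |(x : ℝ) - y| * (‖fourierMoment ν 2 t‖ * |t|))
    (ae_of_all _ fun t _ => by
      rw [norm_mul]
      calc _ ≤ ‖fourierMoment ν 2 t‖ * (2 * Real.pi * |((-x : ℤ) : ℝ) - (-y : ℤ)| * |t|) := by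
            gcongr
            exact norm_character_sub_le _ _ _
        _ = _ := by
            push_cast
            rw [show -(x : ℝ) - -(y : ℝ) = -(x - y) by ring, abs_neg]
            ring)
    (Continuous.intervalIntegrable (by fun_prop) _ _)
  rw [h1, intervalIntegral.integral_const_mul, norm_mul, norm_neg, norm_pow] at h2
  simp only [Complex.norm_real, norm_mul, Complex.norm_ofNat, Real.norm_eq_abs,
    abs_of_pos Real.pi_pos] at h2
  set Z := |(x : ℝ) ^ 2 * ν.real {x} - (y : ℝ) ^ 2 * ν.real {y}|
  have h3 : 2 * Real.pi * (2 * Real.pi * Z) ≤ 2 * Real.pi * (J * |(x : ℝ) - y|) := by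
    calc 2 * Real.pi * (2 * Real.pi * Z) = (2 * Real.pi) ^ 2 * Z := by ring
      _ ≤ _ := h2
      _ ≤ 2 * Real.pi * |(x : ℝ) - y| * J := by gcongr
      _ = _ := by ring
  have h4 := le_of_mul_le_mul_left h3 Real.two_pi_pos
  have hZ : 0 ≤ Z := abs_nonneg _
  -- What was obtained is 2πZ ≤ J|x - y|; the gain 2π ≥ 1 is discarded.
  nlinarith

/-- A weighted `L¹` bound on the second derivative of the Fourier transform gives the smoothness
estimate of Bellow and Calderón for the weights. -/
theorem smoothness_of_integral_le [IsProbabilityMeasure ν] (hν : secondMoment ν ≠ ∞) {J : ℝ}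
    (hJ : ∫ t in (-(1 / 2) : ℝ)..(1 / 2), ‖fourierMoment ν 2 t‖ * |t| ≤ J) {x y : ℤ}
    (hxy : 2 * (x - y).natAbs ≤ x.natAbs) :
    ν {x} ≤ ν {y} + ENNReal.ofReal (4 * J) *
      ((x - y).natAbs * ((x.natAbs : ℝ≥0∞) ^ 2)⁻¹) := by
  have hJ0 : 0 ≤ J := le_trans
    (intervalIntegral.integral_nonneg (by norm_num) fun t _ => by positivity) hJ
  rcases eq_or_ne x 0 with rfl | hx
  · have : y = 0 := by
      have := Int.natAbs_zero
      omega
    rw [this]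
    exact le_self_add
  have hx0 : (0 : ℝ) < |(x : ℝ)| := by simpa using hx
  have hxn : 0 < x.natAbs := Int.natAbs_pos.2 hx
  have hxy' : 2 * |(x : ℝ) - y| ≤ |(x : ℝ)| := by
    have h : ((2 * (x - y).natAbs : ℕ) : ℝ) ≤ (x.natAbs : ℕ) := Nat.cast_le.2 hxy
    simpa using h
  have hy : |(x : ℝ)| ≤ 2 * |(y : ℝ)| := by
    have := abs_sub_abs_le_abs_sub (x : ℝ) y
    linarith
  have hy0 : 0 < |(y : ℝ)| := by linarith
  have h1 := abs_sq_mul_sub_le hν hJ x y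
  -- The Lipschitz bound against the point 0 gives y² ν(y) ≤ J|y|.
  have h2 : |(y : ℝ)| * ν.real {y} ≤ J := by
    have h := abs_sq_mul_sub_le hν hJ y 0
    have hnn : (0 : ℝ) ≤ ν.real {y} := measureReal_nonneg
    simp only [Int.cast_zero, sub_zero, ne_eq, OfNat.ofNat_ne_zero, not_false_eq_true, zero_pow,
      zero_mul] at h
    rw [abs_of_nonneg (by positivity), ← sq_abs, sq, mul_assoc, mul_comm J] at h
    exact le_of_mul_le_mul_left h hy0
  -- Write x²(ν(x) - ν(y)) = (x²ν(x) - y²ν(y)) + (y² - x²)ν(y). The first term costs J|x - y|, the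
  -- second 3J|x - y| because |x + y| ≤ 3|y|; hence the 4.
  have h3 : |(x : ℝ)| ^ 2 * (ν.real {x} - ν.real {y}) ≤ 4 * J * |(x : ℝ) - y| := by
    have h4 : (y : ℝ) ^ 2 - x ^ 2 ≤ |(x : ℝ) - y| * (3 * |(y : ℝ)|) := by
      calc (y : ℝ) ^ 2 - x ^ 2 ≤ |(x - y) * ((x : ℝ) + y)| := by
            rw [← abs_neg]
            exact (le_of_eq (by ring)).trans (le_abs_self _)
        _ = |(x : ℝ) - y| * |(x : ℝ) + y| := abs_mul _ _
        _ ≤ _ := by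
            gcongr
            exact (abs_add_le _ _).trans (by linarith)
    have h5 : ((y : ℝ) ^ 2 - x ^ 2) * ν.real {y} ≤ |(x : ℝ) - y| * 3 * J := by
      calc ((y : ℝ) ^ 2 - x ^ 2) * ν.real {y} ≤ |(x : ℝ) - y| * (3 * |(y : ℝ)|) * ν.real {y} := by
            gcongr
        _ = |(x : ℝ) - y| * 3 * (|(y : ℝ)| * ν.real {y}) := by ring
        _ ≤ _ := by gcongr
    rw [sq_abs]
    have h6 := (abs_le.1 h1).2
    linarith
  have h7 : ν.real {x} ≤ ν.real {y} + 4 * J * (|(x : ℝ) - y| * (|(x : ℝ)| ^ 2)⁻¹) := by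
    have : ν.real {x} - ν.real {y} ≤ 4 * J * |(x : ℝ) - y| / |(x : ℝ)| ^ 2 := by
      rw [le_div_iff₀ (by positivity), mul_comm]
      exact h3
    rw [div_eq_mul_inv] at this
    linarith
  have h8 := ENNReal.ofReal_le_ofReal h7
  rw [ENNReal.ofReal_add measureReal_nonneg (by positivity), ofReal_measureReal,
    ofReal_measureReal, ENNReal.ofReal_mul (by positivity),
    ENNReal.ofReal_mul (abs_nonneg _), ENNReal.ofReal_inv_of_pos (by positivity),
    ENNReal.ofReal_pow (abs_nonneg _)] at h8
  have h9 : ∀ z : ℤ, ENNReal.ofReal |(z : ℝ)| = (z.natAbs : ℝ≥0∞) := fun z => by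
    rw [← ENNReal.ofReal_natCast, Nat.cast_natAbs, Int.cast_abs]
  rw [h9, show (x : ℝ) - y = ((x - y : ℤ) : ℝ) by push_cast; ring, h9] at h8
  exact h8

end FourierMoments

/-! ### Gaussian bounds for convolution products -/

section ConvolutionProducts

theorem fourierMoment_conv {μ ν : Measure ℤ} [IsProbabilityMeasure μ] [IsProbabilityMeasure ν]
    (hμ : secondMoment μ ≠ ∞) (hν : secondMoment ν ≠ ∞) (t : ℝ) :
    fourierMoment (μ.conv ν) 1 t =
        fourierMoment μ 1 t * fourier ν t + fourier μ t * fourierMoment ν 1 t ∧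
      fourierMoment (μ.conv ν) 2 t =
        fourierMoment μ 2 t * fourier ν t + 2 * (fourierMoment μ 1 t * fourierMoment ν 1 t) +
          fourier μ t * fourierMoment ν 2 t := by
  have hc := secondMoment_conv_ne_top hμ hν
  have h0 : fourierMoment (μ.conv ν) 0 = fourierMoment μ 0 * fourierMoment ν 0 := by
    ext s
    simp only [fourierMoment_zero, Pi.mul_apply]
    exact fourier_conv μ ν s
  have h1 : fourierMoment (μ.conv ν) 1 = fourierMoment μ 1 * fourierMoment ν 0 +
      fourierMoment μ 0 * fourierMoment ν 1 := by
    ext s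
    refine (hasDerivAt_fourierMoment hc (j := 0) (by norm_num) s).unique ?_
    rw [h0]
    exact (hasDerivAt_fourierMoment hμ (j := 0) (by norm_num) s).mul
      (hasDerivAt_fourierMoment hν (j := 0) (by norm_num) s)
  refine ⟨by rw [h1, fourierMoment_zero, fourierMoment_zero]; rfl, ?_⟩
  refine (hasDerivAt_fourierMoment hc (j := 1) (by norm_num) t).unique ?_
  rw [h1]
  have hμ0 := hasDerivAt_fourierMoment hμ (j := 0) (by norm_num) t
  have hν0 := hasDerivAt_fourierMoment hν (j := 0) (by norm_num) t
  have hμ1 := hasDerivAt_fourierMoment hμ (j := 1) (by norm_num) t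
  have hν1 := hasDerivAt_fourierMoment hν (j := 1) (by norm_num) t
  refine ((hμ1.mul hν0).add (hμ0.mul hν1)).congr_deriv ?_
  simp only [fourierMoment_zero, zero_add, Nat.reduceAdd]
  ring

theorem isProbabilityMeasure_convProd {ν : ℕ → Measure ℤ}
    (hprob : ∀ n, 1 ≤ n → IsProbabilityMeasure (ν n)) (n : ℕ) :
    IsProbabilityMeasure (convProd ν n) := by
  induction n with
  | zero => exact Measure.dirac.isProbabilityMeasure
  | succ n ih =>
    have := hprob (n + 1) (Nat.le_add_left 1 n)
    rw [convProd]
    infer_instance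

theorem secondMoment_convProd_ne_top {ν : ℕ → Measure ℤ}
    (hprob : ∀ n, 1 ≤ n → IsProbabilityMeasure (ν n))
    (hmom : ∀ n, 1 ≤ n → secondMoment (ν n) ≠ ∞) (n : ℕ) :
    secondMoment (convProd ν n) ≠ ∞ := by
  induction n with
  | zero => simp [convProd, secondMoment_eq_lintegral]
  | succ n ih =>
    have := hprob (n + 1) (Nat.le_add_left 1 n)
    have := isProbabilityMeasure_convProd hprob n
    exact secondMoment_conv_ne_top ih (hmom (n + 1) (Nat.le_add_left 1 n))

theorem fourierMoment_dirac_zero {j : ℕ} (hj : j ≠ 0) (t : ℝ) :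
    fourierMoment (Measure.dirac 0) j t = 0 := by
  have h : ∀ k : ℤ, ((Measure.dirac (0 : ℤ)).real {k} : ℂ) * (2 * Real.pi * Complex.I * k) ^ j *
      Complex.exp (2 * Real.pi * Complex.I * k * t) = 0 := by
    intro k
    rcases eq_or_ne k 0 with rfl | hk
    · simp [hj]
    · have : (Measure.dirac (0 : ℤ)).real {k} = 0 := by
        simp [measureReal_def, hk.symm]
      rw [this]
      simp
  simp [fourierMoment, h]

/-- Pointwise bounds for the derivatives of the Fourier transform of a convolution product of
centered measures, in terms of bounds `b i` for the Fourier transforms of the factors. -/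
theorem norm_fourierMoment_convProd_le {ν : ℕ → Measure ℤ}
    (hprob : ∀ n, 1 ≤ n → IsProbabilityMeasure (ν n))
    (hmom : ∀ n, 1 ≤ n → secondMoment (ν n) ≠ ∞)
    (hmean : ∀ n, 1 ≤ n → expectation (ν n) = 0) {t q : ℝ} {b : ℕ → ℝ} (hq0 : 0 ≤ q) (hq1 : q ≤ 1)
    (hb : ∀ n, 1 ≤ n → ‖fourier (ν n) t‖ ≤ b n) (hqb : ∀ n, 1 ≤ n → q ≤ b n) (n : ℕ) :
    ‖fourier (convProd ν n) t‖ ≤ ∏ i ∈ Finset.Icc 1 n, b i ∧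
    q * ‖fourierMoment (convProd ν n) 1 t‖ ≤
      (2 * Real.pi) ^ 2 * (∑ i ∈ Finset.Icc 1 n, (secondMoment (ν i)).toReal) * |t| *
        ∏ i ∈ Finset.Icc 1 n, b i ∧
    q ^ 2 * ‖fourierMoment (convProd ν n) 2 t‖ ≤
      ((2 * Real.pi) ^ 2 * (∑ i ∈ Finset.Icc 1 n, (secondMoment (ν i)).toReal) +
        ((2 * Real.pi) ^ 2 * (∑ i ∈ Finset.Icc 1 n, (secondMoment (ν i)).toReal)) ^ 2 * t ^ 2) *
        ∏ i ∈ Finset.Icc 1 n, b i := by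
  -- Leibniz's rule yields products with one or two factors b i missing. Since q ≤ b i, multiplying
  -- by q or q² restores the full product without dividing by any b i, and the induction closes.
  induction n with
  | zero =>
    have := isProbabilityMeasure_convProd hprob 0
    refine ⟨by simpa using norm_fourier_le_one t, ?_, ?_⟩
    · simp [convProd, fourierMoment_dirac_zero]
    · simp [convProd, fourierMoment_dirac_zero]
  | succ n ih =>
    have h1n : 1 ≤ n + 1 := Nat.le_add_left 1 n
    have := hprob (n + 1) h1n
    have := isProbabilityMeasure_convProd hprob n
    have hν := hmom (n + 1) h1n
    have hμ := secondMoment_convProd_ne_top hprob hmom n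
    obtain ⟨e1, e2⟩ := fourierMoment_conv hμ hν t
    have e0 := fourier_conv (convProd ν n) (ν (n + 1)) t
    obtain ⟨i0, i1, i2⟩ := ih
    have n0 := hb (n + 1) h1n
    have n1 := norm_fourierMoment_one_le hν (hmean (n + 1) h1n) t
    have n2 := norm_fourierMoment_two_le hν t
    have hqb' := hqb (n + 1) h1n
    rw [Finset.prod_Icc_succ_top h1n, Finset.sum_Icc_succ_top h1n]
    simp only [convProd]
    rw [e0, e1, e2]
    have hS : 0 ≤ ∑ i ∈ Finset.Icc 1 n, (secondMoment (ν i)).toReal :=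
      Finset.sum_nonneg fun _ _ => ENNReal.toReal_nonneg
    have hM : 0 ≤ (secondMoment (ν (n + 1))).toReal := ENNReal.toReal_nonneg
    have hP : 0 ≤ ∏ i ∈ Finset.Icc 1 n, b i := (norm_nonneg _).trans i0
    have hβ : 0 ≤ b (n + 1) := hq0.trans hqb'
    set S := ∑ i ∈ Finset.Icc 1 n, (secondMoment (ν i)).toReal
    set M := (secondMoment (ν (n + 1))).toReal
    set P := ∏ i ∈ Finset.Icc 1 n, b i
    set β := b (n + 1)
    set c := (2 * Real.pi) ^ 2 with hc
    have hc0 : 0 ≤ c := by positivity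
    set F0 := fourier (convProd ν n) t
    set F1 := fourierMoment (convProd ν n) 1 t
    set F2 := fourierMoment (convProd ν n) 2 t
    set G0 := fourier (ν (n + 1)) t
    set G1 := fourierMoment (ν (n + 1)) 1 t
    set G2 := fourierMoment (ν (n + 1)) 2 t
    refine ⟨?_, ?_, ?_⟩
    · rw [norm_mul]
      gcongr
    · calc q * ‖F1 * G0 + F0 * G1‖ ≤ q * (‖F1‖ * ‖G0‖ + ‖F0‖ * ‖G1‖) := by
            gcongr
            exact (norm_add_le _ _).trans (by rw [norm_mul, norm_mul])
        _ = (q * ‖F1‖) * ‖G0‖ + ‖F0‖ * (q * ‖G1‖) := by ring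
        _ ≤ (c * S * |t| * P) * β + P * (β * (c * M * |t|)) := by gcongr
        _ = _ := by ring
    · calc q ^ 2 * ‖F2 * G0 + 2 * (F1 * G1) + F0 * G2‖
          ≤ q ^ 2 * (‖F2‖ * ‖G0‖ + 2 * (‖F1‖ * ‖G1‖) + ‖F0‖ * ‖G2‖) := by
            gcongr
            refine (norm_add₃_le).trans (le_of_eq ?_)
            simp
        _ = (q ^ 2 * ‖F2‖) * ‖G0‖ + 2 * ((q * ‖F1‖) * (q * ‖G1‖)) +
              ‖F0‖ * (q * (q * ‖G2‖)) := by ring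
        -- In the last term only one factor is missing: one q becomes β, the other is bounded by 1.
        _ ≤ ((c * S + (c * S) ^ 2 * t ^ 2) * P) * β +
              2 * ((c * S * |t| * P) * (β * (c * M * |t|))) + P * (1 * (β * (c * M))) := by
            gcongr
        _ = (c * (S + M) + ((c * S) ^ 2 + 2 * (c * S) * (c * M)) * t ^ 2) * (P * β) := by
            rw [← sq_abs t]
            ring
        _ ≤ _ := by
            gcongr
            nlinarith [mul_nonneg hc0 hM]

theorem integral_abs_mul_exp_le {a : ℝ} (ha : 0 < a) :
    ∫ t in (-(1 / 2) : ℝ)..(1 / 2), |t| * Real.exp (-a * t ^ 2) ≤ 1 / a := by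
  have hcont : Continuous fun t : ℝ => |t| * Real.exp (-a * t ^ 2) := by fun_prop
  have hhalf : ∫ t in (0 : ℝ)..(1 / 2), |t| * Real.exp (-a * t ^ 2) ≤ 1 / (2 * a) := by
    have h1 : ∀ t ∈ Set.uIcc (0 : ℝ) (1 / 2), HasDerivAt
        (fun t => -(1 / (2 * a)) * Real.exp (-a * t ^ 2)) (|t| * Real.exp (-a * t ^ 2)) t := by
      intro t ht
      rw [Set.uIcc_of_le (by norm_num)] at ht
      have h2 : HasDerivAt (fun t : ℝ => -a * t ^ 2) (-a * (2 * t)) t := by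
        simpa using (hasDerivAt_pow 2 t).const_mul (-a)
      refine (h2.exp.const_mul _).congr_deriv ?_
      rw [abs_of_nonneg ht.1]
      field_simp
    rw [intervalIntegral.integral_eq_sub_of_hasDerivAt h1 (hcont.intervalIntegrable _ _)]
    have h3 : 0 ≤ 1 / (2 * a) * Real.exp (-a * (1 / 2) ^ 2) := by positivity
    simp only [ne_eq, OfNat.ofNat_ne_zero, not_false_eq_true, zero_pow, mul_zero, Real.exp_zero]
    linarith
  have hneg : ∫ t in (-(1 / 2) : ℝ)..0, |t| * Real.exp (-a * t ^ 2) =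
      ∫ t in (0 : ℝ)..(1 / 2), |t| * Real.exp (-a * t ^ 2) := by
    have h := intervalIntegral.integral_comp_neg (a := 0) (b := 1 / 2)
      (fun t : ℝ => |t| * Real.exp (-a * t ^ 2))
    simp only [abs_neg, neg_sq, neg_zero] at h
    exact h.symm
  rw [← intervalIntegral.integral_add_adjacent_intervals (hcont.intervalIntegrable _ 0)
    (hcont.intervalIntegrable 0 _), hneg]
  have : 1 / a = 1 / (2 * a) + 1 / (2 * a) := by
    field_simp
    norm_num
  linarith

/-- Finitely many initial n are handled by comparing with n + N, where the eventual bound holds; K(n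
+ N) ≤ (K + KN)n since n ≥ 1. -/
theorem exists_linear_bound {ν : ℕ → Measure ℤ} {K : ℝ≥0}
    (hK : ∀ᶠ n : ℕ in atTop,
      ∑ i ∈ Finset.Icc 1 n, secondMoment (ν i) ≤ (K : ℝ≥0∞) * (n : ℝ≥0∞)) :
    (∀ n, 1 ≤ n → secondMoment (ν n) ≠ ∞) ∧ ∃ B : ℝ, 0 ≤ B ∧ ∀ n : ℕ, 1 ≤ n →
      ∑ i ∈ Finset.Icc 1 n, (secondMoment (ν i)).toReal ≤ B * n := by
  obtain ⟨N, hN⟩ := eventually_atTop.1 hK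
  have hfin : ∀ n, 1 ≤ n → secondMoment (ν n) ≠ ∞ := by
    intro n hn
    refine ne_top_of_le_ne_top ?_ ((Finset.single_le_sum (f := fun i => secondMoment (ν i))
      (fun _ _ => zero_le) (Finset.mem_Icc.2 ⟨hn, le_max_left n N⟩)).trans
      (hN (max n N) (le_max_right n N)))
    finiteness
  have hsum : ∀ n, N ≤ n → ∑ i ∈ Finset.Icc 1 n, (secondMoment (ν i)).toReal ≤ K * n := by
    intro n hn
    rw [← ENNReal.toReal_sum fun i hi => hfin i (Finset.mem_Icc.1 hi).1]
    have h := ENNReal.toReal_mono (by finiteness) (hN n hn)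
    simpa using h
  refine ⟨hfin, K + K * N, by positivity, fun n hn => ?_⟩
  have hn' : (1 : ℝ) ≤ n := by exact_mod_cast hn
  have hKN : (0 : ℝ) ≤ K * N := by positivity
  calc ∑ i ∈ Finset.Icc 1 n, (secondMoment (ν i)).toReal
      ≤ ∑ i ∈ Finset.Icc 1 (n + N), (secondMoment (ν i)).toReal :=
        Finset.sum_le_sum_of_subset_of_nonneg
          (Finset.Icc_subset_Icc_right (Nat.le_add_right n N)) fun _ _ _ => ENNReal.toReal_nonneg
    _ ≤ K * (n + N : ℕ) := hsum _ (Nat.le_add_left N n)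
    _ ≤ _ := by
        push_cast
        nlinarith

/-- Pointwise |μ̂_n''(t)| ≤ A n exp(-Cnt²/2) inside the interval; as ∫ |t| exp(-at²) ≤ 1/a with a =
Cn/2, the factor n cancels and 2A/C remains. -/
theorem exists_integral_fourierMoment_le {ν : ℕ → Measure ℤ}
    (hprob : ∀ n, 1 ≤ n → IsProbabilityMeasure (ν n))
    (hmean : ∀ n, 1 ≤ n → expectation (ν n) = 0)
    (hmom : ∀ n, 1 ≤ n → secondMoment (ν n) ≠ ∞) {B : ℝ} (hB0 : 0 ≤ B)
    (hB : ∀ n : ℕ, 1 ≤ n → ∑ i ∈ Finset.Icc 1 n, (secondMoment (ν i)).toReal ≤ B * n)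
    {C : ℝ} (hC : 0 < C) {N₀ : ℕ} (hgauss : ∀ n, N₀ < n → ∀ t ∈ Set.Ico (-(1 / 2) : ℝ) (1 / 2),
      ‖fourier (ν n) t‖ ≤ Real.exp (-C * t ^ 2)) :
    ∃ J : ℝ, ∀ n, 1 ≤ n → ∫ t in (-(1 / 2) : ℝ)..(1 / 2),
      ‖fourierMoment (convProd ν n) 2 t‖ * |t| ≤ J := by
  set c : ℝ := (2 * Real.pi) ^ 2 with hc
  have hc0 : 0 ≤ c := by positivity
  set A : ℝ := Real.exp (C * (N₀ + 2) / 4) * (c * B + (c * B) ^ 2 * (2 / C)) with hA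
  have hA0 : 0 ≤ A := by positivity
  have hpt : ∀ n : ℕ, 1 ≤ n → ∀ t ∈ Set.Ioo (-(1 / 2) : ℝ) (1 / 2),
      ‖fourierMoment (convProd ν n) 2 t‖ ≤ A * n * Real.exp (-(C / 2 * n) * t ^ 2) := by
    intro n hn t ht
    set q := Real.exp (-C * t ^ 2) with hq
    have hq0 : 0 < q := Real.exp_pos _
    have hq1 : q ≤ 1 := Real.exp_le_one_iff.2 (by nlinarith [sq_nonneg t])
    set b : ℕ → ℝ := fun i => if i ≤ N₀ then 1 else q with hb
    have hmain := (norm_fourierMoment_convProd_le hprob hmom hmean (b := b) hq0.le hq1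
      (fun i hi => by
        by_cases h : i ≤ N₀
        · have := hprob i hi
          simpa [hb, h] using norm_fourier_le_one t
        · rw [show b i = q from if_neg h]
          exact hgauss i (not_le.1 h) t ⟨ht.1.le, ht.2⟩)
      (fun i _ => by
        by_cases h : i ≤ N₀
        · simpa [hb, h] using hq1
        · simp [hb, h]) n).2.2
    -- Treating the first N₀ factors as 1 costs at most q ^ N₀; in this form the bound also covers k
    -- ≤ N₀.
    have hprod : ∀ k, q ^ N₀ * ∏ i ∈ Finset.Icc 1 k, b i ≤ q ^ k := by
      intro k
      rcases le_total k N₀ with h | h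
      · rw [Finset.prod_congr rfl (g := fun _ => (1 : ℝ)) fun i hi =>
          if_pos ((Finset.mem_Icc.1 hi).2.trans h), Finset.prod_const_one, mul_one]
        exact pow_le_pow_of_le_one hq0.le hq1 h
      · induction k, h using Nat.le_induction with
        | base =>
          rw [Finset.prod_congr rfl (g := fun _ => (1 : ℝ)) fun i hi =>
            if_pos (Finset.mem_Icc.1 hi).2, Finset.prod_const_one, mul_one]
        | succ k hk ih =>
          rw [Finset.prod_Icc_succ_top (Nat.le_add_left 1 k), ← mul_assoc, pow_succ]
          have : b (k + 1) = q := if_neg (by omega)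
          rw [this]
          gcongr
    set S := ∑ i ∈ Finset.Icc 1 n, (secondMoment (ν i)).toReal
    have hS0 : 0 ≤ S := Finset.sum_nonneg fun _ _ => ENNReal.toReal_nonneg
    have hSB : S ≤ B * n := hB n hn
    set Φ := ‖fourierMoment (convProd ν n) 2 t‖
    have hΦ : q ^ (N₀ + 2) * Φ ≤ (c * (B * n) + (c * (B * n)) ^ 2 * t ^ 2) * q ^ n := by
      calc q ^ (N₀ + 2) * Φ = q ^ N₀ * (q ^ 2 * Φ) := by ring
        _ ≤ q ^ N₀ * ((c * S + (c * S) ^ 2 * t ^ 2) * ∏ i ∈ Finset.Icc 1 n, b i) := by gcongr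
        _ = (c * S + (c * S) ^ 2 * t ^ 2) * (q ^ N₀ * ∏ i ∈ Finset.Icc 1 n, b i) := by ring
        _ ≤ _ := by
            gcongr
            exact hprod n
    have ht2 : t ^ 2 ≤ 1 / 4 := by nlinarith [ht.1, ht.2]
    -- On |t| ≤ 1/2 the negative power q^{-(N₀+2)} is bounded by a constant: N₀ for the uncontrolled
    -- factors, 2 from the Leibniz bound.
    have hG : 1 ≤ Real.exp (C * (N₀ + 2) / 4) * q ^ (N₀ + 2) := by
      rw [hq, ← Real.exp_nat_mul, ← Real.exp_add, Real.one_le_exp_iff]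
      push_cast
      have : C * (N₀ + 2) * t ^ 2 ≤ C * (N₀ + 2) * (1 / 4) := by gcongr
      linarith
    -- Half of the Gaussian absorbs n t² through x exp(-x) ≤ 1; the other half is kept for the
    -- integration.
    have hqn : q ^ n = Real.exp (-(C / 2 * n) * t ^ 2) * Real.exp (-(C / 2 * n * t ^ 2)) := by
      rw [hq, ← Real.exp_nat_mul, ← Real.exp_add]
      congr 1
      ring
    have hxe : n * t ^ 2 * Real.exp (-(C / 2 * n * t ^ 2)) ≤ 2 / C := by
      have h1 : C / 2 * n * t ^ 2 * Real.exp (-(C / 2 * n * t ^ 2)) ≤ 1 := by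
        rw [Real.exp_neg, ← div_eq_mul_inv, div_le_one (Real.exp_pos _)]
        linarith [Real.add_one_le_exp (C / 2 * n * t ^ 2)]
      rw [le_div_iff₀ hC]
      linarith
    have he1 : Real.exp (-(C / 2 * n * t ^ 2)) ≤ 1 :=
      Real.exp_le_one_iff.2 (neg_nonpos.2 (by positivity))
    set e := Real.exp (-(C / 2 * n * t ^ 2))
    set e' := Real.exp (-(C / 2 * n) * t ^ 2)
    calc Φ = 1 * Φ := (one_mul _).symm
      _ ≤ Real.exp (C * (N₀ + 2) / 4) * q ^ (N₀ + 2) * Φ := by gcongr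
      _ = Real.exp (C * (N₀ + 2) / 4) * (q ^ (N₀ + 2) * Φ) := by ring
      _ ≤ Real.exp (C * (N₀ + 2) / 4) *
            ((c * (B * n) + (c * (B * n)) ^ 2 * t ^ 2) * q ^ n) := by gcongr
      _ = Real.exp (C * (N₀ + 2) / 4) *
            (c * B * e + (c * B) ^ 2 * (n * t ^ 2 * e)) * n * e' := by
          rw [hqn]
          ring
      _ ≤ Real.exp (C * (N₀ + 2) / 4) * (c * B * 1 + (c * B) ^ 2 * (2 / C)) * n * e' := by
          gcongr
      _ = _ := by rw [hA, mul_one]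
  refine ⟨A * (2 / C), fun n hn => ?_⟩
  have := isProbabilityMeasure_convProd hprob n
  have hcont := continuous_fourierMoment (secondMoment_convProd_ne_top hprob hmom n) le_rfl
  have hn0 : (0 : ℝ) < n := by exact_mod_cast hn
  calc ∫ t in (-(1 / 2) : ℝ)..(1 / 2), ‖fourierMoment (convProd ν n) 2 t‖ * |t|
      ≤ ∫ t in (-(1 / 2) : ℝ)..(1 / 2), A * n * (|t| * Real.exp (-(C / 2 * n) * t ^ 2)) := by
        -- The open interval suffices, so no Gaussian bound at t = 1/2 is required.
        refine intervalIntegral.integral_mono_on_of_le_Ioo (by norm_num)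
          (Continuous.intervalIntegrable (by fun_prop) _ _)
          (Continuous.intervalIntegrable (by fun_prop) _ _) fun t ht => ?_
        calc _ ≤ A * n * Real.exp (-(C / 2 * n) * t ^ 2) * |t| := by
              gcongr
              exact hpt n hn t ht
          _ = _ := by ring
    _ ≤ A * n * (1 / (C / 2 * n)) := by
        rw [intervalIntegral.integral_const_mul]
        gcongr
        exact integral_abs_mul_exp_le (by positivity)
    _ = _ := by field_simp

end ConvolutionProducts

end ConvolutionAverages

end

/-! ### The theorem -/

theorem theorem2p1p3 {X : Type*} [MeasurableSpace X] (m : Measure X) [IsProbabilityMeasure m]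
    (τ : X ≃ᵐ X) (hτ : MeasurePreserving τ m m)
    (ν : ℕ → Measure ℤ) (hprob : ∀ n, 1 ≤ n → IsProbabilityMeasure (ν n))
    (haper : ∀ n, 1 ≤ n → ConvolutionAverages.StrictlyAperiodic (ν n))
    (hmean : ∀ n, 1 ≤ n → ConvolutionAverages.expectation (ν n) = 0)
    (hmom : ∃ K : ℝ≥0, ∀ᶠ n : ℕ in atTop,
      ∑ i ∈ Finset.Icc 1 n, ConvolutionAverages.secondMoment (ν i) ≤ (K : ℝ≥0∞) * (n : ℝ≥0∞))
    (hgauss : ∃ C : ℝ, 0 < C ∧ ∃ N₀ : ℕ, 0 < N₀ ∧ ∀ n, N₀ < n →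
      ∀ t ∈ Set.Ico (-(1 / 2) : ℝ) (1 / 2),
        ‖ConvolutionAverages.fourier (ν n) t‖ ≤ Real.exp (-C * t ^ 2)) :
    ((∀ n, 1 ≤ n →
        ContDiff ℝ 2 (ConvolutionAverages.fourier (ConvolutionAverages.convProd ν n))) ∧
      (⨆ (n : ℕ) (_ : 1 ≤ n), ∫⁻ t in Set.Icc (-(1 / 2) : ℝ) (1 / 2),
        ENNReal.ofReal
          (‖iteratedDeriv 2
            (ConvolutionAverages.fourier (ConvolutionAverages.convProd ν n)) t‖ * |t|)) < ∞) ∧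
    ConvolutionAverages.WeakType11 m
      (ConvolutionAverages.maximal τ (ConvolutionAverages.convProd ν)) := by
  obtain ⟨K, hK⟩ := hmom
  obtain ⟨C, hC, N₀, -, hg⟩ := hgauss
  obtain ⟨hfin, B, hB0, hB⟩ := ConvolutionAverages.exists_linear_bound hK
  obtain ⟨J, hJ⟩ :=
    ConvolutionAverages.exists_integral_fourierMoment_le hprob hmean hfin hB0 hB hC hg
  have hμ := ConvolutionAverages.isProbabilityMeasure_convProd hprob
  have hμ2 := ConvolutionAverages.secondMoment_convProd_ne_top hprob hfin
  refine ⟨⟨fun n _ => ConvolutionAverages.contDiff_two_fourier (hμ2 n), ?_⟩, ?_⟩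
  · refine lt_of_le_of_lt (iSup₂_le fun n hn => ?_) (ENNReal.ofReal_lt_top (r := J))
    have hcont := ConvolutionAverages.continuous_fourierMoment (hμ2 n) le_rfl
    rw [ConvolutionAverages.iteratedDeriv_two_fourier (hμ2 n), ← ofReal_integral_eq_lintegral_ofReal
      ((Continuous.continuousOn (by fun_prop)).integrableOn_Icc)
      (ae_of_all _ fun t => by positivity)]
    refine ENNReal.ofReal_le_ofReal (le_trans (le_of_eq ?_) (hJ n hn))
    rw [intervalIntegral.integral_of_le (by norm_num), integral_Icc_eq_integral_Ioc]
  · exact ConvolutionAverages.weakType11_maximal hτ _ (fun n _ => hμ n) ENNReal.ofReal_ne_top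
      fun n hn x y hxy => ConvolutionAverages.smoothness_of_integral_le (hμ2 n) (hJ n hn) hxy
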